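/- **Convergence to constant stationary states for small Péclet number.** Let $\Omega=(0,2\pi)^2$, $\Upsilon=\Omega\times(0,2\pi)=(0,2\pi)^3$, and write $\xi=(x,\theta)\in\Upsilon$, $\mathbf e(\theta)=(\cos\theta,\sin\theta)$. Let $\mathrm{Pe}\in\mathbb R$ and $D_e>0$, and consider, with periodic boundary conditions in $x$ and $\theta$, the equation $$\partial_t f+\mathrm{Pe}\,\mathrm{div}\big((1-\rho)f\,\mathbf e(\theta)\big)=D_e\Delta f+\partial_\theta^2 f,\qquad \rho(t,x)=\int_0^{2\pi}f(t,x,\theta)\,d\theta, \tag{1}$$ where $\mathrm{div},\nabla,\Delta$ act in $x$ only; $\nabla_\xi$ denotes the gradient in $\xi$. Here $L^2_{\mathrm{per}}(\Upsilon)$ and $H^1_{\mathrm{per}}(\Upsilon)$ denote the usual spaces of functions that are $2\pi$-periodic in each variable, and $\langle g\rangle=|\Upsilon|^{-1}\int_\Upsilon g\,d\xi$. Let $f_0\in L^2_{\mathrm{per}}(\Upsilon)$ be non-negative with $\int_0^{2\pi}f_0(x,\theta)\,d\theta\in[0,1]$ for a.e. $x\in\Omega$. Let $f$ be the global weak solution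 of (1) with initial datum $f_0$, that is, for every $T>0$: $f\in C([0,T];L^2_{\mathrm{per}}(\Upsilon))\cap L^2(0,T;H^1_{\mathrm{per}}(\Upsilon))$, $\partial_t f\in L^2(0,T;(H^1_{\mathrm{per}})'(\Upsilon))$, $0\le\rho\le1$ a.e. in $(0,T)\times\Omega$, $f(t)\to f_0$ in $L^2(\Upsilon)$ as $t\to0^+$, and for all $\varphi\in L^2(0,T;H^1_{\mathrm{per}}(\Upsilon))$ $$\int_0^T\langle\partial_t f,\varphi\rangle\,dt=\mathrm{Pe}\int_0^T\!\!\int_\Upsilon(1-\rho)f\,\mathbf e(\theta)\cdot\nabla\varphi\,d\xi\,dt-D_e\int_0^T\!\!\int_\Upsilon\nabla f\cdot\nabla\varphi\,d\xi\,dt-\int_0^T\!\!\int_\Upsilon\partial_\theta f\,\partial_\theta\varphi\,d\xi\,dt.$$ Let $C_P$ be the Poincaré constant of $\Upsilon$, i.e. the smallest constant such that $\|u-\langle u\rangle\|_{L^2(\Upsilon)}\le C_P\|\nabla_\xi u\|_{L^2(\Upsilon)}$ for all $u\in H^1_{\mathrm{per}}(\Upsilon)$, and suppose that $$|\mathrm{Pe}|<\frac{\min\{D_e,1\}}{2\sqrt2\,\pi\,C_P\,(1+\langle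 f_0\rangle)}.$$ Then $$\kappa:=\frac12\Big(\frac12C_P^{-2}\min\{D_e,1\}-\frac{(2\pi)^2\mathrm{Pe}^2(1+\langle f_0\rangle)^2}{\min\{D_e,1\}}\Big)>0,$$ and $$\|f(t,\cdot)-\langle f_0\rangle\|_{L^2(\Upsilon)}\le e^{-\kappa t}\,\|f_0-\langle f_0\rangle\|_{L^2(\Upsilon)}\qquad\text{for all }t\ge0.$$ -/

import Mathlib

open MeasureTheory Set Filter Topology
open scoped ContDiff

noncomputable section

namespace ActiveParticles

/-- The spatial cell `Ω = (0, 2π)²`. -/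
def Omega : Set (Fin 2 → ℝ) := Set.univ.pi fun _ => Ioo 0 (2 * Real.pi)

/-- The space-angle cell `Υ = Ω × (0, 2π) = (0, 2π)³`; a point `ξ = (x, θ)` has
`x = (ξ 0, ξ 1)` and `θ = ξ 2`. -/
def Upsilon : Set (Fin 3 → ℝ) := Set.univ.pi fun _ => Ioo 0 (2 * Real.pi)

instance isFiniteMeasure_restrict_upsilon : IsFiniteMeasure (volume.restrict Upsilon) := by
  refine ⟨?_⟩
  rw [Measure.restrict_apply_univ, Upsilon, volume_pi, Measure.pi_pi]
  exact ENNReal.prod_lt_top fun i _ => by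
    rw [Real.volume_Ioo]
    exact ENNReal.ofReal_lt_top

/-- `L²_per(Υ)`: a periodic function is identified with its restriction to the cell `Υ`. -/
abbrev L2per : Type := Lp ℝ 2 (volume.restrict Upsilon)

/-- Smooth functions on `ℝ³` that are `2π`-periodic in each variable. -/
def IsPeriodicTest (φ : (Fin 3 → ℝ) → ℝ) : Prop :=
  ContDiff ℝ ∞ φ ∧ ∀ (i : Fin 3) (ξ : Fin 3 → ℝ), φ (ξ + Pi.single i (2 * Real.pi)) = φ ξ

/-- The classical partial derivative `∂_i φ`. -/
def partialDeriv (i : Fin 3) (φ : (Fin 3 → ℝ) → ℝ) (ξ : Fin 3 → ℝ) : ℝ :=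
  fderiv ℝ φ ξ (Pi.single i 1)

/-- `g_i` is the weak derivative `∂_i g` of the periodic function `g`, tested against smooth
periodic functions (so jumps across the faces of the cell are not allowed). -/
def IsWeakPartial (i : Fin 3) (g gi : L2per) : Prop :=
  ∀ φ : (Fin 3 → ℝ) → ℝ, IsPeriodicTest φ →
    ∫ ξ in Upsilon, g ξ * partialDeriv i φ ξ = -∫ ξ in Upsilon, gi ξ * φ ξ

/-- A continuous function is bounded on `Υ`, so its product with an `L²` function is
integrable. -/
theorem integrable_mul_of_continuous (g : L2per) {φ : (Fin 3 → ℝ) → ℝ} (hφ : Continuous φ) :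
    Integrable (fun ξ => g ξ * φ ξ) (volume.restrict Upsilon) := by
  have hg : Integrable g (volume.restrict Upsilon) := (Lp.memLp g).integrable (by norm_num)
  have hK : IsCompact (Set.univ.pi fun _ : Fin 3 => Icc (0 : ℝ) (2 * Real.pi)) :=
    isCompact_univ_pi fun _ => isCompact_Icc
  obtain ⟨C, hC⟩ := hK.exists_bound_of_continuousOn hφ.continuousOn
  refine hg.mul_bdd (c := C) hφ.aestronglyMeasurable ?_
  have hm : MeasurableSet Upsilon := MeasurableSet.univ_pi fun _ => measurableSet_Ioo
  filter_upwards [ae_restrict_mem hm] with ξ hξ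
  exact hC ξ fun i hi => Ioo_subset_Icc_self (hξ i hi)

theorem IsPeriodicTest.continuous_partialDeriv {φ : (Fin 3 → ℝ) → ℝ} (hφ : IsPeriodicTest φ)
    (i : Fin 3) : Continuous (partialDeriv i φ) :=
  (hφ.1.continuous_fderiv (by simp)).clm_apply continuous_const

/-- `H¹_per(Υ)` as the space of tuples `(g, ∂₀ g, ∂₁ g, ∂₂ g)` in `(L²)⁴`;
its norm is `(‖g‖² + ‖∂₀ g‖² + ‖∂₁ g‖² + ‖∂₂ g‖²)^(1/2)`. -/
def H1Sub : Submodule ℝ (PiLp 2 fun _ : Fin 4 => L2per) where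
  carrier := {u | ∀ i : Fin 3, IsWeakPartial i (u 0) (u i.succ)}
  zero_mem' := by
    intro i φ _
    have h : ∀ ψ : (Fin 3 → ℝ) → ℝ, ∫ ξ in Upsilon, (0 : L2per) ξ * ψ ξ = 0 := by
      intro ψ
      rw [← integral_zero (Fin 3 → ℝ) ℝ (μ := volume.restrict Upsilon)]
      refine integral_congr_ae ?_
      filter_upwards [Lp.coeFn_zero ℝ 2 (volume.restrict Upsilon)] with ξ hξ
      rw [hξ, Pi.zero_apply, zero_mul]
    simp only [PiLp.zero_apply, h, neg_zero]
  add_mem' := by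
    intro u v hu hv i φ hφ
    have h : ∀ (a b : L2per) (ψ : (Fin 3 → ℝ) → ℝ), Continuous ψ →
        ∫ ξ in Upsilon, (a + b) ξ * ψ ξ
          = (∫ ξ in Upsilon, a ξ * ψ ξ) + ∫ ξ in Upsilon, b ξ * ψ ξ := by
      intro a b ψ hψ
      rw [← integral_add (integrable_mul_of_continuous a hψ) (integrable_mul_of_continuous b hψ)]
      refine integral_congr_ae ?_
      filter_upwards [Lp.coeFn_add a b] with ξ hξ
      simp only [hξ, Pi.add_apply, add_mul]
    simp only [PiLp.add_apply]
    rw [h _ _ _ (hφ.continuous_partialDeriv i), h _ _ _ hφ.1.continuous, hu i φ hφ, hv i φ hφ,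
      neg_add]
  smul_mem' := by
    intro c u hu i φ hφ
    have h : ∀ (a : L2per) (ψ : (Fin 3 → ℝ) → ℝ),
        ∫ ξ in Upsilon, (c • a) ξ * ψ ξ = c * ∫ ξ in Upsilon, a ξ * ψ ξ := by
      intro a ψ
      rw [← integral_const_mul]
      refine integral_congr_ae ?_
      filter_upwards [Lp.coeFn_smul c a] with ξ hξ
      simp only [hξ, Pi.smul_apply, smul_eq_mul, mul_assoc]
    simp only [PiLp.smul_apply]
    rw [h, h, hu i φ hφ, mul_neg]

/-- The Hilbert space `H¹_per(Υ)`, with the structure inherited from `(L²)⁴`. -/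
def H1per : Type := H1Sub

instance instNormedAddCommGroupH1per : NormedAddCommGroup H1per :=
  inferInstanceAs (NormedAddCommGroup H1Sub)

instance instInnerProductSpaceH1per : InnerProductSpace ℝ H1per :=
  inferInstanceAs (InnerProductSpace ℝ H1Sub)

/-- The underlying `L²` function of an element of `H¹_per(Υ)`. -/
def H1per.fn (u : H1per) : L2per := u.1 0

/-- The weak derivative `∂_i u`: `i = 0, 1` are the space variables, `i = 2` the angle. -/
def H1per.grad (u : H1per) (i : Fin 3) : L2per := u.1 i.succ

/-- The space-angle average `⟨g⟩ = |Υ|⁻¹ ∫_Υ g`. -/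
def mean (g : L2per) : ℝ := ⨍ ξ in Upsilon, g ξ

/-- The constant function `c` as an element of `L²_per(Υ)`. -/
def const (c : ℝ) : L2per := Lp.const 2 (volume.restrict Upsilon) c

/-- The Poincaré constant of `Υ`: the best constant in
`‖u - ⟨u⟩‖_{L²(Υ)} ≤ C ‖∇_ξ u‖_{L²(Υ)}` for `u ∈ H¹_per(Υ)`. -/
def poincareConst : ℝ :=
  sInf {C : ℝ | 0 ≤ C ∧ ∀ u : H1per,
    ‖u.fn - const (mean u.fn)‖ ≤ C * Real.sqrt (∑ i : Fin 3, ‖u.grad i‖ ^ 2)}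

/-- The angle-independent density `ρ(x) = ∫₀^{2π} g(x, θ) dθ`. -/
def density (g : L2per) (x : Fin 2 → ℝ) : ℝ :=
  ∫ θ in Ioo 0 (2 * Real.pi), g ![x 0, x 1, θ]

/-- `0 ≤ ρ ≤ 1` almost everywhere in `Ω`. -/
def DensityBounds (g : L2per) : Prop :=
  ∀ᵐ x ∂(volume.restrict Omega), 0 ≤ density g x ∧ density g x ≤ 1

/-- The drift term `∫_Υ (1 - ρ) g e(θ) · ∇φ dξ`, with `e(θ) = (cos θ, sin θ)` and `∇` the
gradient in `x`. -/
def driftForm (g : L2per) (φ : H1per) : ℝ :=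
  ∫ ξ in Upsilon, (1 - density g ![ξ 0, ξ 1]) * g ξ *
    (Real.cos (ξ 2) * φ.grad 0 ξ + Real.sin (ξ 2) * φ.grad 1 ξ)

/-- The spatial diffusion term `∫_Υ ∇u · ∇φ dξ`, with `∇` the gradient in `x`. -/
def spatialForm (u φ : H1per) : ℝ :=
  ∫ ξ in Upsilon, (u.grad 0 ξ * φ.grad 0 ξ + u.grad 1 ξ * φ.grad 1 ξ)

/-- The angular diffusion term `∫_Υ ∂_θ u ∂_θ φ dξ`. -/
def angularForm (u φ : H1per) : ℝ :=
  ∫ ξ in Upsilon, u.grad 2 ξ * φ.grad 2 ξ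

/-- `G : (0, T) → (H¹_per)'` is the weak time derivative of `f : (0, T) → L²_per`, where `L²_per`
is embedded in `(H¹_per)'` by `g ↦ (v ↦ ∫_Υ g v)`. -/
def IsWeakTimeDeriv (T : ℝ) (f : ℝ → L2per) (G : ℝ → StrongDual ℝ H1per) : Prop :=
  ∀ ψ : ℝ → ℝ, ContDiff ℝ ∞ ψ → HasCompactSupport ψ → tsupport ψ ⊆ Ioo 0 T →
    ∀ v : H1per,
      ∫ t in Ioo 0 T, deriv ψ t * ∫ ξ in Upsilon, f t ξ * v.fn ξ
        = -∫ t in Ioo 0 T, ψ t * G t v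

/-- Membership in the Bochner space `L²(0, T; E)`. -/
def MemL2Time {E : Type*} [NormedAddCommGroup E] (T : ℝ) (u : ℝ → E) : Prop :=
  MemLp u 2 (volume.restrict (Ioo 0 T))

/-- `f` is a weak solution on `[0, T]` of
`∂_t f + Pe div((1 - ρ) f e(θ)) = D_e Δ f + ∂_θ² f` with initial datum `f₀`:
`f ∈ C([0,T]; L²_per) ∩ L²(0,T; H¹_per)` (the latter witnessed by `F`) and
`∂_t f ∈ L²(0,T; (H¹_per)')` (this is `G`), the density of `f` lies in `[0, 1]`,
the equation holds against all `φ ∈ L²(0,T; H¹_per)`, and `f(t) → f₀` in `L²` as `t → 0⁺`. -/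
def IsWeakSolution (Pe De T : ℝ) (f₀ : L2per) (f : ℝ → L2per) : Prop :=
  ContinuousOn f (Icc 0 T) ∧
  (∀ᵐ t ∂(volume.restrict (Ioo 0 T)), DensityBounds (f t)) ∧
  Tendsto f (𝓝[>] 0) (𝓝 f₀) ∧
  ∃ (F : ℝ → H1per) (G : ℝ → StrongDual ℝ H1per),
    MemL2Time T F ∧
    (∀ᵐ t ∂(volume.restrict (Ioo 0 T)), (F t).fn = f t) ∧
    MemL2Time T G ∧
    IsWeakTimeDeriv T f G ∧
    ∀ φ : ℝ → H1per, MemL2Time T φ →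
      ∫ t in Ioo 0 T, G t (φ t)
        = Pe * (∫ t in Ioo 0 T, driftForm (f t) (φ t))
          - De * (∫ t in Ioo 0 T, spatialForm (F t) (φ t))
          - ∫ t in Ioo 0 T, angularForm (F t) (φ t)

/-- The decay rate
`κ = ½ (½ C_P⁻² min{D_e, 1} - (2π)² Pe² (1 + m)² / min{D_e, 1})`, with `m` the mean. -/
def decayRate (Pe De m : ℝ) : ℝ :=
  1 / 2 * (1 / 2 * (poincareConst ^ 2)⁻¹ * min De 1
    - (2 * Real.pi) ^ 2 * Pe ^ 2 * (1 + m) ^ 2 / min De 1)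

end ActiveParticles

end

/-! Write m = ⟨f₀⟩, μ = min {D_e, 1} and y = ‖f - m‖². Testing the equation with the constant 1
shows that the mean of f(t) stays equal to m (`mean_eq_of_isWeakSolution`). Testing with f - m gives
half the derivative of y as the drift term minus the two diffusion terms.

In the drift, (1 - ρ) f = (1 - ρ)(f - m) - m (ρ - 2πm) + m (1 - 2πm). The last summand is constant
and drops out because e(θ) is divergence free in x. As 0 ≤ ρ ≤ 1 and ‖ρ - 2πm‖ ≤ 2π ‖f - m‖ by
Cauchy-Schwarz in θ, the rest has norm at most (1 + 2πm) ‖f - m‖. Young's inequality then bounds the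
drift by K y + (μ/2) ‖∇f‖² with K = Pe² (1 + 2πm)² / (2μ) (`abs_mul_driftForm_le`). Diffusion
absorbs the gradient and leaves at least half of μ ‖∇_ξ f‖², which the Poincaré inequality turns
into decay of y. Since K + κ ≤ μ / (2 C_P²), the derivative of y is at most -2κ y, and Grönwall's
lemma concludes.

The analytic difficulty is that the time derivative of f lies only in the dual of H¹. Testing with f
itself requires the energy identity `norm_sq_sub_norm_sq_eq_integral`, proved abstractly from
averaged time increments and L²-continuity of translations. All estimates are kept in
time-integrated form. -/

namespace ActiveParticles

/-! ### Functions of time -/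

/-- A continuous function that is orthogonal to all derivatives of test functions is constant. -/
theorem eq_of_forall_integral_deriv_mul_eq_zero {T : ℝ} (hT : 0 < T) {w : ℝ → ℝ}
    (hw : ContinuousOn w (Icc 0 T))
    (h : ∀ ψ : ℝ → ℝ, ContDiff ℝ ∞ ψ → HasCompactSupport ψ → tsupport ψ ⊆ Ioo 0 T →
      ∫ t in Ioo 0 T, deriv ψ t * w t = 0) :
    ∀ t ∈ Icc 0 T, w t = w 0 := by
  have hwI : IntegrableOn w (Ioo 0 T) :=
    (hw.integrableOn_compact isCompact_Icc).mono_set Ioo_subset_Icc_self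
  have hmul : ∀ φ : ℝ → ℝ, Continuous φ → IntegrableOn (fun t => φ t * w t) (Ioo 0 T) := by
    intro φ hφ
    exact ((hφ.continuousOn.mul hw).integrableOn_compact isCompact_Icc).mono_set
      Ioo_subset_Icc_self
  -- a normalized bump
  obtain ⟨χ, hχ1, hχ2, hχ3, hχ4⟩ : ∃ χ : ℝ → ℝ, ContDiff ℝ ∞ χ ∧ HasCompactSupport χ ∧
      tsupport χ ⊆ Ioo 0 T ∧ ∫ t, χ t = 1 := by
    let b : ContDiffBump (T / 2 : ℝ) := ⟨T / 8, T / 4, by linarith, by linarith⟩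
    refine ⟨b.normed volume, b.contDiff_normed, b.hasCompactSupport_normed, ?_,
      b.integral_normed⟩
    rw [b.tsupport_normed_eq, Real.closedBall_eq_Icc]
    intro x hx
    simp only [b, mem_Icc] at hx
    constructor <;> linarith [hx.1, hx.2]
  set K := ∫ t in Ioo 0 T, χ t * w t with hK
  have key : ∀ φ : ℝ → ℝ, ContDiff ℝ ∞ φ → HasCompactSupport φ → tsupport φ ⊆ Ioo 0 T →
      ∫ t, φ t • (w t - K) * (Ioo 0 T).indicator 1 t = 0 := by
    intro φ h1 h2 h3
    set c := ∫ t, φ t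
    -- Removing c χ makes the integral zero, so the primitive ψ of η is compactly supported in (0,
    -- T) and is an admissible test function. The hypothesis for ψ then says that φ is orthogonal to
    -- w - K.
    let η : ℝ → ℝ := fun t => φ t - c * χ t
    have hη : ContDiff ℝ ∞ η := h1.sub (contDiff_const.mul hχ1)
    have hηc := hη.continuous
    have hφI : Integrable φ := h1.continuous.integrable_of_hasCompactSupport h2
    have hχI : Integrable χ := hχ1.continuous.integrable_of_hasCompactSupport hχ2
    have hηint : ∫ t, η t = 0 := by
      simp only [η]
      rw [integral_sub hφI (hχI.const_mul c), integral_const_mul, hχ4, mul_one, sub_self]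
    obtain ⟨α, β, hα, hβ, hsub⟩ : ∃ α β, 0 < α ∧ β < T ∧
        tsupport φ ∪ tsupport χ ⊆ Icc α β := by
      have hc : IsCompact (tsupport φ ∪ tsupport χ) := h2.isCompact.union hχ2.isCompact
      have hs : tsupport φ ∪ tsupport χ ⊆ Ioo 0 T := union_subset h3 hχ3
      have hne : (tsupport φ ∪ tsupport χ).Nonempty := by
        by_contra hcon
        rw [not_nonempty_iff_eq_empty, union_empty_iff] at hcon
        have : χ = 0 := by
          rw [← tsupport_eq_empty_iff]; exact hcon.2
        rw [this] at hχ4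
        simp at hχ4
      obtain ⟨α, hα⟩ := hc.exists_isLeast hne
      obtain ⟨β, hβ⟩ := hc.exists_isGreatest hne
      exact ⟨α, β, (hs hα.1).1, (hs hβ.1).2, fun x hx => ⟨hα.2 hx, hβ.2 hx⟩⟩
    have hη0 : ∀ t, t ∉ Icc α β → η t = 0 := by
      intro t ht
      have a1 : φ t = 0 := image_eq_zero_of_notMem_tsupport fun hh => ht (hsub (Or.inl hh))
      have a2 : χ t = 0 := image_eq_zero_of_notMem_tsupport fun hh => ht (hsub (Or.inr hh))
      simp [η, a1, a2]
    let ψ : ℝ → ℝ := fun t => ∫ s in (0 : ℝ)..t, η s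
    have hψd : ∀ t, HasDerivAt ψ (η t) t := fun t =>
      intervalIntegral.integral_hasDerivAt_right (hηc.intervalIntegrable _ _)
        (hηc.stronglyMeasurableAtFilter _ _) hηc.continuousAt
    have hψ' : deriv ψ = η := funext fun t => (hψd t).deriv
    have hψs : ContDiff ℝ ∞ ψ := by
      rw [contDiff_infty_iff_deriv, hψ']
      exact ⟨fun t => (hψd t).differentiableAt, hη⟩
    have hηI : Integrable η := hφI.sub (hχI.const_mul c)
    have hψ0 : ∀ t, t ∉ Icc α β → ψ t = 0 := by
      intro t ht
      rcases lt_or_ge t α with hlt | hge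
      · simp only [ψ]
        rw [intervalIntegral.integral_congr (g := fun _ => 0), intervalIntegral.integral_zero]
        intro s hs
        apply hη0
        intro hh
        rcases le_total 0 t with h0 | h0
        · rw [uIcc_of_le h0] at hs; linarith [hs.2, hh.1]
        · rw [uIcc_of_ge h0] at hs; linarith [hs.2, hh.1]
      -- To the right of β the primitive has collected the whole integral of η, which is zero.
      · have hlt : β < t := by
          by_contra hcon; exact ht ⟨hge, not_lt.1 hcon⟩
        simp only [ψ]
        rw [intervalIntegral.integral_of_le (by linarith), ← hηint]
        apply setIntegral_eq_integral_of_forall_compl_eq_zero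
        intro s hs
        apply hη0
        intro hh
        exact hs ⟨by linarith [hh.1], by linarith [hh.2]⟩
    have hψt : tsupport ψ ⊆ Icc α β :=
      closure_minimal (fun t ht => by_contra fun hh => ht (hψ0 t hh)) isClosed_Icc
    have h4 := h ψ hψs (isCompact_Icc.of_isClosed_subset (isClosed_tsupport _) hψt)
      (hψt.trans (Icc_subset_Ioo hα hβ))
    rw [hψ'] at h4
    have e1 : ∫ t in Ioo 0 T, φ t = c :=
      setIntegral_eq_integral_of_forall_compl_eq_zero fun s hs =>
        image_eq_zero_of_notMem_tsupport fun hh => hs (h3 hh)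
    have e2 : ∫ t in Ioo 0 T, η t * w t = (∫ t in Ioo 0 T, φ t * w t) - c * K := by
      rw [hK, ← integral_const_mul, ← integral_sub (hmul φ h1.continuous)
        ((hmul χ hχ1.continuous).const_mul c)]
      congr 1; ext t; simp only [η]; ring
    rw [e2] at h4
    have e3 : ∫ t, φ t • (w t - K) * (Ioo 0 T).indicator 1 t
        = ∫ t in Ioo 0 T, (φ t * w t - φ t * K) := by
      rw [← integral_indicator measurableSet_Ioo]
      congr 1; ext t
      by_cases ht : t ∈ Ioo 0 T
      · simp only [ht, indicator_of_mem, Pi.one_apply, smul_eq_mul]; ring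
      · simp [ht]
    rw [e3, integral_sub (hmul φ h1.continuous) (hφI.integrableOn.mul_const K),
      integral_mul_const, e1, h4]
  have hloc : LocallyIntegrableOn (fun t => w t - K) (Ioo 0 T) :=
    (hwI.sub (integrableOn_const (by simp))).locallyIntegrableOn
  have hae := isOpen_Ioo.ae_eq_zero_of_integral_contDiff_smul_eq_zero hloc (by
    intro φ h1 h2 h3
    rw [← key φ h1 h2 h3]
    congr 1; ext t
    by_cases ht : t ∈ Ioo 0 T
    · simp [ht]
    · have : φ t = 0 := image_eq_zero_of_notMem_tsupport fun hh => ht (h3 hh)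
      simp [this])
  have hIoo : EqOn w (fun _ => K) (Ioo 0 T) := by
    refine Measure.eqOn_open_of_ae_eq (μ := volume) ?_ isOpen_Ioo (hw.mono Ioo_subset_Icc_self)
      continuousOn_const
    rw [Filter.EventuallyEq, ae_restrict_iff' measurableSet_Ioo]
    filter_upwards [hae] with t ht hm using sub_eq_zero.1 (ht hm)
  have hIcc : EqOn w (fun _ => K) (Icc 0 T) := by
    refine hIoo.of_subset_closure hw continuousOn_const Ioo_subset_Icc_self ?_
    rw [closure_Ioo hT.ne]
  intro t ht
  rw [hIcc ht, hIcc ⟨le_rfl, hT.le⟩]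

/-- A continuous function with an integrable weak derivative is the primitive of the latter. -/
theorem eq_add_integral_of_weak_deriv {T : ℝ} (hT : 0 < T) {y g : ℝ → ℝ}
    (hy : ContinuousOn y (Icc 0 T)) (hg : IntegrableOn g (Ioo 0 T))
    (h : ∀ ψ : ℝ → ℝ, ContDiff ℝ ∞ ψ → HasCompactSupport ψ → tsupport ψ ⊆ Ioo 0 T →
      ∫ t in Ioo 0 T, deriv ψ t * y t = -∫ t in Ioo 0 T, ψ t * g t) :
    ∀ t ∈ Icc 0 T, y t = y 0 + ∫ s in (0 : ℝ)..t, g s := by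
  have hgi : IntervalIntegrable g volume 0 T :=
    (intervalIntegrable_iff_integrableOn_Ioo_of_le hT.le).2 hg
  have hV := hgi.absolutelyContinuousOnInterval_intervalIntegral (c := 0) (by simp)
  set V : ℝ → ℝ := fun t => ∫ s in (0 : ℝ)..t, g s with hVdef
  have hVc : ContinuousOn V (Icc 0 T) := by
    have := hV.continuousOn
    rwa [uIcc_of_le hT.le] at this
  -- The primitive V is absolutely continuous, so integration by parts gives it the weak derivative
  -- g. Hence y - V has weak derivative zero.
  have hw := eq_of_forall_integral_deriv_mul_eq_zero hT (hy.sub hVc) (by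
    intro ψ h1 h2 h3
    have hψ0 : ψ 0 = 0 := image_eq_zero_of_notMem_tsupport fun hh => lt_irrefl _ (h3 hh).1
    have hψT : ψ T = 0 := image_eq_zero_of_notMem_tsupport fun hh => lt_irrefl _ (h3 hh).2
    have hψ : AbsolutelyContinuousOnInterval ψ 0 T :=
      (h1.contDiffOn.of_le (by simp)).absolutelyContinuousOnInterval
    have hibp := hψ.integral_mul_deriv_eq_deriv_mul hV
    have e1 : ∫ x in (0 : ℝ)..T, ψ x * deriv V x = ∫ x in (0 : ℝ)..T, ψ x * g x := by
      apply intervalIntegral.integral_congr_ae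
      filter_upwards [hgi.ae_hasDerivAt_integral] with x hx hxm
      rw [(hx (uIoc_subset_uIcc hxm) 0 (by simp)).deriv]
    rw [e1, hψ0, hψT, zero_mul, zero_mul, sub_self, zero_sub,
      intervalIntegral.integral_of_le hT.le, intervalIntegral.integral_of_le hT.le,
      integral_Ioc_eq_integral_Ioo, integral_Ioc_eq_integral_Ioo] at hibp
    have hd : Continuous (deriv ψ) := h1.continuous_deriv (by simp)
    have i1 : IntegrableOn (fun t => deriv ψ t * y t) (Ioo 0 T) :=
      ((hd.continuousOn.mul hy).integrableOn_compact isCompact_Icc).mono_set Ioo_subset_Icc_self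
    have i2 : IntegrableOn (fun t => deriv ψ t * V t) (Ioo 0 T) :=
      ((hd.continuousOn.mul hVc).integrableOn_compact isCompact_Icc).mono_set
        Ioo_subset_Icc_self
    simp only [mul_sub, Pi.sub_apply]
    rw [integral_sub i1 i2, h ψ h1 h2 h3, hibp, neg_neg, sub_self])
  intro t ht
  have := hw t ht
  simp only [Pi.sub_apply, hVdef, intervalIntegral.integral_same, sub_zero] at this
  linarith

/-- Translations act continuously on square integrable functions. -/
theorem tendsto_eLpNorm_translate_sub {E : Type*} [NormedAddCommGroup E] {F : ℝ → E}
    (hF : MemLp F 2 volume) :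
    Tendsto (fun h : ℝ => eLpNorm (fun t => F (t + h) - F t) 2 volume) (𝓝 0) (𝓝 0) := by
  have hm : ∀ h : ℝ, MeasurePreserving (ContinuousMap.mk (fun t : ℝ => t + h)
      (by fun_prop)) volume volume := fun h => measurePreserving_add_right volume h
  have hg : Continuous fun h : ℝ => ContinuousMap.mk (fun t : ℝ => t + h) (by fun_prop) :=
    ContinuousMap.continuous_of_continuous_uncurry _ (by simp; fun_prop)
  have hc : Continuous fun h : ℝ => Lp.compMeasurePreserving _ (hm h) (hF.toLp F) :=
    continuous_const.compMeasurePreservingLp hg hm (by simp)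
  have h0 := tendsto_iff_edist_tendsto_0.1 (hc.tendsto 0)
  simp only [Lp.toLp_compMeasurePreserving, Lp.edist_toLp_toLp] at h0
  refine h0.congr fun h => ?_
  congr 1
  ext t
  simp

/-! ### Duality pairings of functions that are square integrable in time -/

section Pairing

variable {V : Type*} [NormedAddCommGroup V] [NormedSpace ℝ V]

theorem aestronglyMeasurable_dual_apply {α : Type*} [MeasurableSpace α] {μ : Measure α}
    {G : α → StrongDual ℝ V} {F : α → V} (hG : AEStronglyMeasurable G μ)
    (hF : AEStronglyMeasurable F μ) : AEStronglyMeasurable (fun t => G t (F t)) μ :=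
  isBoundedBilinearMap_apply.continuous.comp_aestronglyMeasurable (hG.prodMk hF)

theorem eLpNorm_dual_apply_le {α : Type*} [MeasurableSpace α] {μ : Measure α}
    {G : α → StrongDual ℝ V} {F : α → V} (hG : AEStronglyMeasurable G μ)
    (hF : AEStronglyMeasurable F μ) :
    eLpNorm (fun t => G t (F t)) 1 μ ≤ eLpNorm G 2 μ * eLpNorm F 2 μ := by
  have h := eLpNorm_le_eLpNorm_mul_eLpNorm_of_nnnorm (p := 2) (q := 2) (r := 1) hG hF
    (fun g v => g v) 1 (Eventually.of_forall fun t => by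
      simpa using (G t).le_opNNNorm (F t))
  simpa using h

theorem integrable_dual_apply {α : Type*} [MeasurableSpace α] {μ : Measure α}
    {G : α → StrongDual ℝ V} {F : α → V} (hG : MemLp G 2 μ) (hF : MemLp F 2 μ) :
    Integrable (fun t => G t (F t)) μ :=
  memLp_one_iff_integrable.1 ⟨aestronglyMeasurable_dual_apply hG.1 hF.1,
    (eLpNorm_dual_apply_le hG.1 hF.1).trans_lt (ENNReal.mul_lt_top hG.2 hF.2)⟩

theorem abs_integral_dual_apply_le {α : Type*} [MeasurableSpace α] {μ : Measure α}
    {G : α → StrongDual ℝ V} {F : α → V} (hG : MemLp G 2 μ) (hF : MemLp F 2 μ) :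
    |∫ t, G t (F t) ∂μ| ≤ (eLpNorm G 2 μ).toReal * (eLpNorm F 2 μ).toReal := by
  rw [← ENNReal.toReal_mul, ← Real.norm_eq_abs]
  refine (norm_integral_le_integral_norm _).trans ?_
  rw [integral_norm_eq_lintegral_enorm (aestronglyMeasurable_dual_apply hG.1 hF.1),
    ← eLpNorm_one_eq_lintegral_enorm]
  exact ENNReal.toReal_mono (ENNReal.mul_lt_top hG.2 hF.2).ne
    (eLpNorm_dual_apply_le hG.1 hF.1)

theorem memLp_translate {E : Type*} [NormedAddCommGroup E] {F : ℝ → E}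
    (hF : MemLp F 2 volume) (h : ℝ) : MemLp (fun t => F (t + h)) 2 volume :=
  hF.comp_measurePreserving (measurePreserving_add_right volume h)

theorem toReal_eLpNorm_restrict_le {E : Type*} [NormedAddCommGroup E] {F : ℝ → E}
    (hF : MemLp F 2 volume) (s : Set ℝ) :
    (eLpNorm F 2 (volume.restrict s)).toReal ≤ (eLpNorm F 2 volume).toReal :=
  ENNReal.toReal_mono hF.2.ne (eLpNorm_mono_measure _ Measure.restrict_le_self)

theorem toReal_eLpNorm_translate {E : Type*} [NormedAddCommGroup E] {F : ℝ → E}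
    (hF : MemLp F 2 volume) (h : ℝ) :
    (eLpNorm (fun t => F (t + h)) 2 volume).toReal = (eLpNorm F 2 volume).toReal := by
  congr 1
  exact eLpNorm_comp_measurePreserving hF.1 (measurePreserving_add_right volume h)

/-- The pairing of two translated functions differs little from the pairing of the functions. -/
theorem abs_integral_translate_pairing_sub_le {G : ℝ → StrongDual ℝ V} {F : ℝ → V}
    (hG : MemLp G 2 volume) (hF : MemLp F 2 volume) (s : Set ℝ) (σ h : ℝ) :
    |(∫ t in s, G (t + σ) (F (t + h) + F t)) - 2 * ∫ t in s, G t (F t)|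
      ≤ (eLpNorm (fun t => G (t + σ) - G t) 2 volume).toReal
          * (2 * (eLpNorm F 2 volume).toReal)
        + (eLpNorm G 2 volume).toReal
          * (eLpNorm (fun t => F (t + h) - F t) 2 volume).toReal := by
  have hGσ := memLp_translate hG σ
  have hFh := memLp_translate hF h
  have hG' : MemLp (fun t => G (t + σ) - G t) 2 volume := hGσ.sub hG
  have hF' : MemLp (fun t => F (t + h) - F t) 2 volume := hFh.sub hF
  have hS : MemLp (fun t => F (t + h) + F t) 2 volume := hFh.add hF
  -- Each summand contains one difference of translates, and each such difference is small in L².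
  have e : (∫ t in s, G (t + σ) (F (t + h) + F t)) - 2 * ∫ t in s, G t (F t)
      = (∫ t in s, (G (t + σ) - G t) (F (t + h) + F t))
        + ∫ t in s, G t (F (t + h) - F t) := by
    rw [← integral_const_mul, ← integral_sub
      (integrable_dual_apply (hGσ.restrict s) (hS.restrict s))
      ((integrable_dual_apply (hG.restrict s) (hF.restrict s)).const_mul 2),
      ← integral_add (integrable_dual_apply (hG'.restrict s) (hS.restrict s))
      (integrable_dual_apply (hG.restrict s) (hF'.restrict s))]
    congr 1; ext t
    simp only [sub_apply, map_add, map_sub]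
    ring
  rw [e]
  refine (abs_add_le _ _).trans (add_le_add ?_ ?_)
  · refine (abs_integral_dual_apply_le (hG'.restrict s) (hS.restrict s)).trans ?_
    refine mul_le_mul (toReal_eLpNorm_restrict_le hG' s) ?_ ENNReal.toReal_nonneg
      ENNReal.toReal_nonneg
    refine (toReal_eLpNorm_restrict_le hS s).trans ?_
    rw [two_mul]
    nth_rw 1 [← toReal_eLpNorm_translate hF h]
    rw [← ENNReal.toReal_add hFh.2.ne hF.2.ne]
    exact ENNReal.toReal_mono (ENNReal.add_lt_top.2 ⟨hFh.2, hF.2⟩).ne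
      (eLpNorm_add_le hFh.1 hF.1 (by norm_num))
  · refine (abs_integral_dual_apply_le (hG.restrict s) (hF'.restrict s)).trans ?_
    exact mul_le_mul (toReal_eLpNorm_restrict_le hG s) (toReal_eLpNorm_restrict_le hF' s)
      ENNReal.toReal_nonneg ENNReal.toReal_nonneg

/-- Joint integrability of a translated pairing. -/
theorem integrable_translate_pairing {G : ℝ → StrongDual ℝ V} {Φ : ℝ → V}
    (hG : MemLp G 2 volume) (hΦ : MemLp Φ 2 volume) (a b h : ℝ) :
    Integrable (fun p : ℝ × ℝ => G (p.1 + p.2) (Φ p.1))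
      ((volume.restrict (Ioc a b)).prod (volume.restrict (Ioc 0 h))) := by
  set μ := volume.restrict (Ioc a b)
  set ν := volume.restrict (Ioc 0 h)
  -- The shear (t, σ) ↦ (t, t + σ) preserves μ × Lebesgue measure but not μ × ν, so integrability is
  -- shown for the larger measure and then restricted.
  have hle : μ.prod ν ≤ μ.prod volume := by
    have h1 : μ.prod ν = (μ.prod volume).restrict (univ ×ˢ Ioc 0 h) := by
      rw [← Measure.prod_restrict, Measure.restrict_univ]
    rw [h1]
    exact Measure.restrict_le_self
  have mp : MeasurePreserving (fun p : ℝ × ℝ => (p.1, p.1 + p.2)) (μ.prod volume)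
      (μ.prod volume) := measurePreserving_prod_add μ volume
  have hG2 : Integrable (fun t => ‖G t‖ ^ 2) volume := hG.integrable_norm_pow (by norm_num)
  have hΦ2 : Integrable (fun t => ‖Φ t‖ ^ 2) μ :=
    (hΦ.restrict _).integrable_norm_pow (by norm_num)
  have i1 : Integrable (fun p : ℝ × ℝ => ‖G (p.1 + p.2)‖ ^ 2) (μ.prod ν) := by
    have := mp.integrable_comp_of_integrable (hG2.comp_snd μ)
    exact this.mono_measure hle
  have i2 : Integrable (fun p : ℝ × ℝ => ‖Φ p.1‖ ^ 2) (μ.prod ν) := hΦ2.comp_fst ν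
  have m1 : AEStronglyMeasurable (fun p : ℝ × ℝ => G (p.1 + p.2)) (μ.prod ν) :=
    ((hG.1.comp_snd (μ := μ)).comp_measurePreserving mp).mono_measure hle
  have m2 : AEStronglyMeasurable (fun p : ℝ × ℝ => Φ p.1) (μ.prod ν) := hΦ.1.restrict.comp_fst
  refine (i1.add i2).mono' (aestronglyMeasurable_dual_apply m1 m2)
    (Eventually.of_forall fun p => ?_)
  refine ((G _).le_opNorm _).trans ?_
  simp only [Pi.add_apply]
  nlinarith [sq_nonneg (‖G (p.1 + p.2)‖ - ‖Φ p.1‖), sq_nonneg (‖G (p.1 + p.2)‖ + ‖Φ p.1‖)]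

end Pairing

/-! ### Extension in time to the whole line -/

/-- A continuous function on a compact interval extends to a continuous function. -/
theorem exists_continuous_eqOn_Icc {X : Type*} [TopologicalSpace X] {T : ℝ} (hT : 0 ≤ T)
    {f : ℝ → X} (hf : ContinuousOn f (Icc 0 T)) :
    ∃ g : ℝ → X, Continuous g ∧ ∀ t ∈ Icc 0 T, g t = f t :=
  ⟨IccExtend hT ((Icc 0 T).domRestrict f),
    (continuousOn_iff_continuous_domRestrict.1 hf).Icc_extend', fun t ht => by
      rw [IccExtend_of_mem hT _ ht, domRestrict_apply]⟩

theorem intervalIntegral_indicator_apply {V : Type*} [NormedAddCommGroup V] [NormedSpace ℝ V]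
    {T s t : ℝ} {G : ℝ → StrongDual ℝ V} {v : V} (hs : s ∈ Icc 0 T) (ht : t ∈ Icc 0 T) :
    ∫ τ in s..t, (Ioo 0 T).indicator G τ v = ∫ τ in s..t, G τ v := by
  refine intervalIntegral.integral_congr_ae ?_
  have hne : ∀ᵐ τ : ℝ, τ ∉ ({0, T} : Set ℝ) :=
    measure_eq_zero_iff_ae_notMem.1 ((Set.toFinite {0, T}).measure_zero volume)
  filter_upwards [hne] with τ h2 h1
  have h3 := uIcc_subset_Icc hs ht (uIoc_subset_uIcc h1)
  simp only [mem_insert_iff, mem_singleton_iff, not_or] at h2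
  rw [indicator_of_mem (show τ ∈ Ioo 0 T from ⟨lt_of_le_of_ne h3.1 (Ne.symm h2.1),
    lt_of_le_of_ne h3.2 h2.2⟩)]

theorem memLp_indicator_Ioo {E : Type*} [NormedAddCommGroup E] {a b : ℝ} {F : ℝ → E}
    (hF : MemLp F 2 (volume.restrict (Ioo a b))) : MemLp ((Ioo a b).indicator F) 2 volume :=
  (memLp_indicator_iff_restrict measurableSet_Ioo).2 hF

/-! ### The energy identity -/

section Energy

variable {V H : Type*} [NormedAddCommGroup V] [NormedSpace ℝ V] [NormedAddCommGroup H]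
  [InnerProductSpace ℝ H]

/-- The increment of the energy over a time step, averaged over time. -/
theorem integral_norm_sq_translate_sub {T a b h : ℝ} (ι : V →L[ℝ] H) {f : ℝ → H} {F : ℝ → V}
    {G : ℝ → StrongDual ℝ V} (hF : MemLp F 2 volume) (hG : MemLp G 2 volume)
    (hFf : ∀ᵐ t, t ∈ Ioo 0 T → ι (F t) = f t)
    (hfG : ∀ s ∈ Icc 0 T, ∀ t ∈ Icc 0 T, ∀ v, inner ℝ (f t - f s) (ι v) = ∫ τ in s..t, G τ v)
    (ha : 0 ≤ a) (hh : 0 < h) (hb : b + h < T) :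
    ∫ t in Ioc a b, (‖f (t + h)‖ ^ 2 - ‖f t‖ ^ 2)
      = ∫ σ in Ioc 0 h, ∫ t in Ioc a b, G (t + σ) (F (t + h) + F t) := by
  have hS : MemLp (fun t => F (t + h) + F t) 2 volume :=
    (memLp_translate hF h).add hF
  rw [← integral_integral_swap (f := fun t σ => G (t + σ) (F (t + h) + F t))
    (integrable_translate_pairing hG hS a b h)]
  refine setIntegral_congr_ae measurableSet_Ioc ?_
  have hFf' := (measurePreserving_add_right volume h).quasiMeasurePreserving.ae hFf
  filter_upwards [hFf, hFf'] with t h1 h2 ht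
  have t1 : t ∈ Ioo 0 T := ⟨by linarith [ht.1], by linarith [ht.2]⟩
  have t2 : t + h ∈ Ioo 0 T := ⟨by linarith [ht.1], by linarith [ht.2]⟩
  -- The test vector does not depend on τ, and ι maps it to f (t + h) + f t. The inner product with
  -- f (t + h) - f t is then a difference of squares.
  have e := hfG t (Ioo_subset_Icc_self t1) (t + h) (Ioo_subset_Icc_self t2) (F (t + h) + F t)
  rw [map_add, h1 t1, h2 t2] at e
  have e' : ∫ τ in t..t + h, G τ (F (t + h) + F t)
      = ∫ σ in Ioc 0 h, G (t + σ) (F (t + h) + F t) := by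
    rw [← intervalIntegral.integral_of_le hh.le,
      intervalIntegral.integral_comp_add_left (fun τ => G τ (F (t + h) + F t)) t, add_zero]
  rw [← e', ← e, inner_sub_left, inner_add_right, inner_add_right, real_inner_self_eq_norm_sq,
    real_inner_self_eq_norm_sq, real_inner_comm (f t) (f (t + h))]
  ring

/-- The increments of ‖f‖² over a step h, integrated over [a, b] and divided by h, have two limits
as h → 0⁺. Continuity of f gives the left side; `integral_norm_sq_translate_sub` with the
L²-continuity of translations gives the right side. -/
theorem norm_sq_sub_norm_sq_eq_integral_of_continuous {T a b : ℝ} (ι : V →L[ℝ] H) {f : ℝ → H}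
    {F : ℝ → V} {G : ℝ → StrongDual ℝ V} (hf : Continuous f) (hF : MemLp F 2 volume)
    (hG : MemLp G 2 volume) (hFf : ∀ᵐ t, t ∈ Ioo 0 T → ι (F t) = f t)
    (hfG : ∀ s ∈ Icc 0 T, ∀ t ∈ Icc 0 T, ∀ v, inner ℝ (f t - f s) (ι v) = ∫ τ in s..t, G τ v)
    (ha : 0 ≤ a) (hab : a ≤ b) (hb : b < T) :
    ‖f b‖ ^ 2 - ‖f a‖ ^ 2 = 2 * ∫ t in Ioc a b, G t (F t) := by
  set L := 2 * ∫ t in Ioc a b, G t (F t) with hL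
  set y : ℝ → ℝ := fun t => ‖f t‖ ^ 2 with hy
  have hyc : Continuous y := by fun_prop
  have hyi : ∀ p q, IntervalIntegrable y volume p q := fun p q => hyc.intervalIntegrable p q
  let D : ℝ → ℝ := fun h => ∫ t in Ioc a b, (y (t + h) - y t)
  have hD : ∀ h, D h = (∫ t in b..b + h, y t) - ∫ t in a..a + h, y t := by
    intro h
    simp only [D]
    rw [← intervalIntegral.integral_of_le hab, intervalIntegral.integral_sub
      ((by fun_prop : Continuous fun t => y (t + h)).intervalIntegrable _ _) (hyi _ _),
      intervalIntegral.integral_comp_add_right]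
    have h1 := intervalIntegral.integral_add_adjacent_intervals (hyi a b) (hyi b (b + h))
    have h2 := intervalIntegral.integral_add_adjacent_intervals (hyi a (a + h))
      (hyi (a + h) (b + h))
    linarith
  have hprim : ∀ c, HasDerivAt (fun h => ∫ t in c..c + h, y t) (y c) 0 := by
    intro c
    have h1 : HasDerivAt (fun u => ∫ t in c..u, y t) (y (c + 0)) (c + 0) :=
      intervalIntegral.integral_hasDerivAt_right (hyi _ _)
        (hyc.stronglyMeasurableAtFilter _ _) hyc.continuousAt
    simpa using h1.comp_const_add c 0
  have hDd : HasDerivAt D (y b - y a) 0 := by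
    have := (hprim b).sub (hprim a)
    rwa [show D = _ from funext hD]
  have hD0 : D 0 = 0 := by simp [hD]
  have hlim : Tendsto (fun h => h⁻¹ * D h) (𝓝[>] 0) (𝓝 (y b - y a)) := by
    have := hDd.tendsto_slope_zero_right
    simpa [hD0] using this
  refine tendsto_nhds_unique hlim ?_
  rw [Metric.tendsto_nhds]
  intro ε hε
  set A := (eLpNorm F 2 volume).toReal
  set B := (eLpNorm G 2 volume).toReal
  have hA : 0 ≤ A := ENNReal.toReal_nonneg
  have hB : 0 ≤ B := ENNReal.toReal_nonneg
  have cG : ∀ᶠ h in 𝓝 (0 : ℝ),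
      (eLpNorm (fun t => G (t + h) - G t) 2 volume).toReal * (2 * A) < ε / 4 := by
    have h1 := (ENNReal.tendsto_toReal ENNReal.zero_ne_top).comp (tendsto_eLpNorm_translate_sub hG)
    have h2 := h1.mul_const (2 * A)
    simp only [ENNReal.toReal_zero, zero_mul] at h2
    exact h2.eventually_lt_const (by positivity)
  have cF : ∀ᶠ h in 𝓝 (0 : ℝ),
      B * (eLpNorm (fun t => F (t + h) - F t) 2 volume).toReal < ε / 4 := by
    have h1 := (ENNReal.tendsto_toReal ENNReal.zero_ne_top).comp (tendsto_eLpNorm_translate_sub hF)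
    have h2 := h1.const_mul B
    simp only [ENNReal.toReal_zero, mul_zero] at h2
    exact h2.eventually_lt_const (by positivity)
  obtain ⟨δ, hδ, hball⟩ := Metric.eventually_nhds_iff.1 (cG.and cF)
  -- The bound `T - b` keeps t + h inside the time interval for all t ≤ b.
  have hev : ∀ᶠ h in 𝓝[>] (0 : ℝ), h < min δ (T - b) :=
    eventually_nhdsWithin_of_eventually_nhds
      (eventually_lt_nhds (lt_min hδ (by linarith)))
  filter_upwards [hev, self_mem_nhdsWithin] with h h1 (h2 : 0 < h)
  have hhδ : h < δ := h1.trans_le (min_le_left _ _)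
  have hhT : b + h < T := by linarith [h1.trans_le (min_le_right _ _)]
  have hDh : D h = ∫ σ in Ioc 0 h, ∫ t in Ioc a b, G (t + σ) (F (t + h) + F t) :=
    integral_norm_sq_translate_sub ι hF hG hFf hfG ha h2 hhT
  have hS : MemLp (fun t => F (t + h) + F t) 2 volume :=
    (memLp_translate hF h).add hF
  have hint : IntegrableOn (fun σ => ∫ t in Ioc a b, G (t + σ) (F (t + h) + F t)) (Ioc 0 h) :=
    (integrable_translate_pairing hG hS a b h).integral_prod_right
  have hbd : ‖D h - h * L‖ ≤ ε / 2 * h := by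
    have e : D h - h * L
        = ∫ σ in Ioc 0 h, ((∫ t in Ioc a b, G (t + σ) (F (t + h) + F t)) - L) := by
      rw [integral_sub hint (integrable_const _), hDh]
      simp [h2.le]
    rw [e]
    have := norm_setIntegral_le_of_norm_le_const (μ := volume) (s := Ioc 0 h) (C := ε / 2)
      (f := fun σ => (∫ t in Ioc a b, G (t + σ) (F (t + h) + F t)) - L) (by simp) ?_
    · simpa [h2.le] using this
    -- Since 0 < σ ≤ h < δ, the shift σ of G is as small as the shift h of F; the two errors of ε /
    -- 4 add up.
    · intro σ hσ
      have g1 := (hball (y := σ) (by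
        rw [Real.dist_eq, sub_zero, abs_of_pos hσ.1]; linarith [hσ.2])).1
      have g2 := (hball (y := h) (by rw [Real.dist_eq, sub_zero, abs_of_pos h2]; exact hhδ)).2
      have g3 := abs_integral_translate_pairing_sub_le hG hF (Ioc a b) σ h
      rw [Real.norm_eq_abs]
      linarith
  rw [Real.dist_eq, show h⁻¹ * D h - L = h⁻¹ * (D h - h * L) by field_simp, abs_mul,
    abs_of_pos (inv_pos.2 h2), inv_mul_lt_iff₀ h2]
  rw [Real.norm_eq_abs] at hbd
  nlinarith

/-- The energy identity for a function with values in `H` that is square integrable in time with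
values in `V` and whose derivative is square integrable in time with values in the dual of `V`. -/
theorem norm_sq_sub_norm_sq_eq_integral {T a b : ℝ} (ι : V →L[ℝ] H) {f : ℝ → H}
    {F : ℝ → V} {G : ℝ → StrongDual ℝ V} (hf : ContinuousOn f (Icc 0 T))
    (hF : MemLp F 2 (volume.restrict (Ioo 0 T))) (hG : MemLp G 2 (volume.restrict (Ioo 0 T)))
    (hFf : ∀ᵐ t ∂(volume.restrict (Ioo 0 T)), ι (F t) = f t)
    (hfG : ∀ v, ∀ t ∈ Icc 0 T,
      inner ℝ (f t) (ι v) = inner ℝ (f 0) (ι v) + ∫ τ in (0 : ℝ)..t, G τ v)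
    (ha : 0 ≤ a) (hab : a ≤ b) (hb : b < T) :
    ‖f b‖ ^ 2 - ‖f a‖ ^ 2 = 2 * ∫ t in Ioc a b, G t (F t) := by
  have hT : 0 ≤ T := by linarith
  -- Translations need functions on all of ℝ: f is extended continuously, F and G by zero.
  obtain ⟨f', hf', hff⟩ := exists_continuous_eqOn_Icc hT hf
  have hGv : ∀ v, IntegrableOn (fun t => G t v) (Ioo 0 T) := fun v =>
    integrable_dual_apply hG (memLp_const v)
  have hGi : ∀ v, ∀ t ∈ Icc 0 T, IntervalIntegrable (fun t => G t v) volume 0 t := by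
    intro v t ht
    rw [intervalIntegrable_iff_integrableOn_Ioo_of_le ht.1]
    exact (hGv v).mono_set (Ioo_subset_Ioo_right ht.2)
  have hF' : MemLp ((Ioo 0 T).indicator F) 2 volume := memLp_indicator_Ioo hF
  have hG' : MemLp ((Ioo 0 T).indicator G) 2 volume := memLp_indicator_Ioo hG
  have hFf' : ∀ᵐ t, t ∈ Ioo 0 T → ι ((Ioo 0 T).indicator F t) = f' t := by
    rw [ae_restrict_iff' measurableSet_Ioo] at hFf
    filter_upwards [hFf] with t ht hm
    rw [hff t (Ioo_subset_Icc_self hm), ← ht hm, indicator_of_mem hm]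
  have hfG' : ∀ s ∈ Icc 0 T, ∀ t ∈ Icc 0 T, ∀ v, inner ℝ (f' t - f' s) (ι v)
      = ∫ τ in s..t, (Ioo 0 T).indicator G τ v := by
    intro s hs t ht v
    rw [hff t ht, hff s hs, inner_sub_left, hfG v t ht, hfG v s hs,
      intervalIntegral_indicator_apply hs ht,
      ← intervalIntegral.integral_interval_sub_left (hGi v t ht) (hGi v s hs)]
    ring
  have key := norm_sq_sub_norm_sq_eq_integral_of_continuous ι hf' hF' hG' hFf' hfG' ha hab hb
  rw [hff b ⟨ha.trans hab, hb.le⟩, hff a ⟨ha, hab.trans hb.le⟩] at key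
  rw [key]
  congr 1
  refine setIntegral_congr_fun measurableSet_Ioc fun t ht => ?_
  have : t ∈ Ioo 0 T := ⟨ha.trans_lt ht.1, ht.2.trans_lt hb⟩
  rw [indicator_of_mem this, indicator_of_mem this]

end Energy

/-! ### Grönwall's inequality -/

/-- Exponential decay from an integral inequality. -/
theorem le_exp_mul_of_sub_le_integral {T κ : ℝ} {y : ℝ → ℝ} (hT : 0 ≤ T)
    (hy : ContinuousOn y (Icc 0 T))
    (h : ∀ a b, 0 ≤ a → a ≤ b → b < T → y b - y a ≤ -κ * ∫ t in Ioc a b, y t) :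
    y T ≤ Real.exp (-κ * T) * y 0 := by
  -- The hypothesis bounds the right difference quotients of y at x by -κ times averages of y, which
  -- tend to -κ y(x) by continuity. This suffices for Grönwall, though y need not be differentiable.
  have hg := le_gronwallBound_of_liminf_deriv_right_le (f := y) (f' := fun t => -κ * y t)
    (δ := y 0) (K := -κ) (ε := 0) (a := 0) (b := T) hy ?_ le_rfl (fun x _ => by simp) T
    ⟨hT, le_rfl⟩
  · rw [gronwallBound_ε0, sub_zero] at hg
    linarith
  · intro x hx r hr
    apply Eventually.frequently
    obtain ⟨y', hyc', hyy⟩ := exists_continuous_eqOn_Icc hT hy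
    have h1 : HasDerivAt (fun u => ∫ t in x..u, y' t) (y' x) x :=
      intervalIntegral.integral_hasDerivAt_right (hyc'.intervalIntegrable _ _)
        (hyc'.stronglyMeasurableAtFilter _ _) hyc'.continuousAt
    have h2 := (hasDerivWithinAt_iff_tendsto_slope' (by simp)).1
      (h1.hasDerivWithinAt (s := Ioi x))
    have h3 := (h2.const_mul (-κ)).eventually_lt_const
      (show -κ * y' x < r by rwa [hyy x ⟨hx.1, hx.2.le⟩])
    have h4 : ∀ᶠ z in 𝓝[>] x, z < T :=
      eventually_nhdsWithin_of_eventually_nhds (eventually_lt_nhds hx.2)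
    filter_upwards [h3, h4, self_mem_nhdsWithin] with z z1 z2 (z3 : x < z)
    refine lt_of_le_of_lt ?_ z1
    have h5 := h x z hx.1 z3.le z2
    have h6 : ∫ t in x..z, y' t = ∫ t in Ioc x z, y t := by
      rw [intervalIntegral.integral_of_le z3.le]
      refine setIntegral_congr_fun measurableSet_Ioc fun t ht => hyy t ⟨?_, ?_⟩
      · linarith [hx.1, ht.1]
      · linarith [ht.2]
    rw [slope_def_field, intervalIntegral.integral_same, sub_zero, h6, ← mul_div_assoc,
      div_eq_inv_mul]
    exact mul_le_mul_of_nonneg_left h5 (inv_nonneg.2 (by linarith))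

/-! ### The spaces `L²_per` and `H¹_per` -/

theorem inner_L2per (g h : L2per) : inner ℝ g h = ∫ ξ in Upsilon, g ξ * h ξ := by
  rw [L2.inner_def]
  congr 1; ext ξ
  simp [mul_comm]

theorem norm_sq_L2per (g : L2per) : ‖g‖ ^ 2 = ∫ ξ in Upsilon, g ξ ^ 2 := by
  rw [← real_inner_self_eq_norm_sq, inner_L2per]
  simp only [sq]

theorem integrable_sq_L2per (g : L2per) :
    Integrable (fun ξ => g ξ ^ 2) (volume.restrict Upsilon) :=
  (Lp.memLp g).integrable_sq

theorem integrable_L2per (g : L2per) : Integrable g (volume.restrict Upsilon) :=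
  (Lp.memLp g).integrable (by norm_num)

theorem coeFn_const (c : ℝ) : const c =ᵐ[volume.restrict Upsilon] fun _ => c :=
  Lp.coeFn_const 2 (volume.restrict Upsilon) c

/-- The inclusion of `H¹_per` in `L²_per`. -/
noncomputable def H1per.fnL : H1per →L[ℝ] L2per :=
  ((PiLp.proj 2 (fun _ : Fin 4 => L2per) 0).comp H1Sub.subtypeL : H1Sub →L[ℝ] L2per)

/-- The weak partial derivative as a continuous linear map. -/
noncomputable def H1per.gradL (i : Fin 3) : H1per →L[ℝ] L2per :=
  ((PiLp.proj 2 (fun _ : Fin 4 => L2per) i.succ).comp H1Sub.subtypeL : H1Sub →L[ℝ] L2per)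

theorem H1per.fnL_apply (u : H1per) : H1per.fnL u = u.fn := rfl

theorem H1per.gradL_apply (i : Fin 3) (u : H1per) : H1per.gradL i u = u.grad i := rfl

/-- The integral of a derivative of a periodic function over the cell vanishes. -/
theorem integral_partialDeriv_eq_zero {φ : (Fin 3 → ℝ) → ℝ} (hφ : IsPeriodicTest φ) (i : Fin 3) :
    ∫ ξ in Upsilon, partialDeriv i φ ξ = 0 := by
  have hle : (0 : Fin 3 → ℝ) ≤ fun _ => 2 * Real.pi := fun _ => Real.two_pi_pos.le
  have hd : ∀ x, HasFDerivAt φ (fderiv ℝ φ x) x := fun x =>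
    (hφ.1.differentiable (by simp)).differentiableAt.hasFDerivAt
  -- Divergence theorem for the field with φ in slot i and zero elsewhere.
  have h := integral_divergence_of_hasFDerivAt_off_countable' (0 : Fin 3 → ℝ)
    (fun _ => 2 * Real.pi) hle (fun j => if j = i then φ else 0)
    (fun j x => if j = i then fderiv ℝ φ x else 0) ∅ countable_empty
    (fun j => by
      split_ifs
      · exact hφ.1.continuous.continuousOn
      · exact continuousOn_const)
    (fun x _ j => by
      split_ifs
      · exact hd x
      · exact hasFDerivAt_const 0 x)
    (by
      have : Continuous fun x => ∑ j : Fin 3,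
          (if j = i then fderiv ℝ φ x else 0) (Pi.single j (1 : ℝ)) := by
        refine continuous_finsetSum _ fun j _ => ?_
        split_ifs
        · exact (hφ.1.continuous_fderiv (by simp)).clm_apply continuous_const
        · exact continuous_const
      exact this.continuousOn.integrableOn_compact isCompact_Icc)
  have e1 : ∀ x, (∑ j : Fin 3, (if j = i then fderiv ℝ φ x else 0) (Pi.single j (1 : ℝ)))
      = partialDeriv i φ x := by
    intro x
    rw [Finset.sum_eq_single i (fun j _ hj => by simp [hj]) (by simp)]
    simp [partialDeriv]
  simp only [e1] at h
  have hU : Upsilon =ᵐ[volume] Icc (0 : Fin 3 → ℝ) (fun _ => 2 * Real.pi) :=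
    Measure.univ_pi_Ioo_ae_eq_Icc
  rw [setIntegral_congr_set hU, h]
  refine Finset.sum_eq_zero fun j _ => ?_
  rw [sub_eq_zero]
  refine integral_congr_ae (Eventually.of_forall fun x => ?_)
  -- Opposite faces in direction i differ by one period, so their contributions cancel.
  by_cases hj : j = i
  · subst hj
    simp only [if_true]
    rw [← hφ.2 j (Fin.insertNth j ((0 : Fin 3 → ℝ) j) x)]
    congr 1
    ext k
    refine Fin.succAboveCases j ?_ (fun l => ?_) k
    · simp
    · simp
  · simp [hj]

/-- The constant function `1` as an element of `H¹_per`. -/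
noncomputable def oneH1 : H1per :=
  (⟨WithLp.toLp 2 ![const 1, 0, 0, 0], by
    intro i φ hφ
    have h0 : ∫ ξ in Upsilon, (0 : L2per) ξ * φ ξ = 0 := by
      rw [← integral_zero (Fin 3 → ℝ) ℝ (μ := volume.restrict Upsilon)]
      refine integral_congr_ae ?_
      filter_upwards [Lp.coeFn_zero ℝ 2 (volume.restrict Upsilon)] with ξ hξ
      rw [hξ, Pi.zero_apply, zero_mul]
    have h1 : ∫ ξ in Upsilon, const 1 ξ * partialDeriv i φ ξ = 0 := by
      rw [← integral_partialDeriv_eq_zero hφ i]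
      refine integral_congr_ae ?_
      filter_upwards [coeFn_const 1] with ξ hξ
      rw [hξ, one_mul]
    have h2 : ∫ ξ in Upsilon, const 1 ξ * partialDeriv i φ ξ
        = -∫ ξ in Upsilon, (0 : L2per) ξ * φ ξ := by rw [h0, h1, neg_zero]
    fin_cases i <;> exact h2⟩ : H1Sub)

theorem fn_oneH1 : oneH1.fn = const 1 := rfl

theorem grad_oneH1 (i : Fin 3) : oneH1.grad i = 0 := by
  fin_cases i <;> rfl

theorem const_eq_smul (c : ℝ) : const c = c • const 1 := by
  refine Lp.ext ?_
  filter_upwards [coeFn_const c, coeFn_const 1, Lp.coeFn_smul c (const 1)] with ξ h1 h2 h3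
  rw [h1, h3, Pi.smul_apply, h2, smul_eq_mul, mul_one]

theorem fn_sub_smul_oneH1 (u : H1per) (c : ℝ) : (u - c • oneH1).fn = u.fn - const c := by
  rw [← H1per.fnL_apply, map_sub, map_smul, H1per.fnL_apply, H1per.fnL_apply, fn_oneH1,
    ← const_eq_smul]

theorem grad_sub_smul_oneH1 (u : H1per) (c : ℝ) (i : Fin 3) :
    (u - c • oneH1).grad i = u.grad i := by
  rw [← H1per.gradL_apply, map_sub, map_smul, H1per.gradL_apply, H1per.gradL_apply, grad_oneH1,
    smul_zero, sub_zero]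

/-! ### Means -/

theorem volume_real_Upsilon : volume.real Upsilon = (2 * Real.pi) ^ 3 := by
  rw [Measure.real, Upsilon, volume_pi, Measure.pi_pi]
  simp [Real.pi_pos.le]

/-- As a pairing with an element of H¹, the mean can be followed in time by the weak formulation. -/
theorem mean_eq_inner (g : L2per) :
    mean g = ((2 * Real.pi) ^ 3)⁻¹ * inner ℝ g (const 1) := by
  rw [mean, setAverage_eq, volume_real_Upsilon, smul_eq_mul, inner_L2per]
  congr 1
  refine integral_congr_ae ?_
  filter_upwards [coeFn_const 1] with ξ hξ
  rw [hξ, mul_one]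

theorem mean_nonneg {g : L2per} (hg : ∀ᵐ ξ ∂(volume.restrict Upsilon), 0 ≤ g ξ) :
    0 ≤ mean g := by
  rw [mean, setAverage_eq, smul_eq_mul]
  exact mul_nonneg (by positivity) (integral_nonneg_of_ae hg)

theorem poincareConst_nonneg : 0 ≤ poincareConst :=
  Real.sInf_nonneg fun _ hC => hC.1

/-- The Poincaré inequality holds with the best constant. -/
theorem norm_sub_mean_sq_le (hC : 0 < poincareConst) (u : H1per) :
    ‖u.fn - const (mean u.fn)‖ ^ 2 ≤ poincareConst ^ 2 * ∑ i : Fin 3, ‖u.grad i‖ ^ 2 := by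
  set S := {C : ℝ | 0 ≤ C ∧ ∀ u : H1per,
    ‖u.fn - const (mean u.fn)‖ ≤ C * Real.sqrt (∑ i : Fin 3, ‖u.grad i‖ ^ 2)} with hS
  -- If no constant were admissible, the junk value `sInf ∅ = 0` would contradict `hC`. Positivity
  -- thus replaces a proof of the Poincaré inequality.
  have hne : S.Nonempty := by
    by_contra h
    rw [not_nonempty_iff_eq_empty] at h
    rw [poincareConst, ← hS, h, Real.sInf_empty] at hC
    exact lt_irrefl _ hC
  have hsum : 0 ≤ ∑ i : Fin 3, ‖u.grad i‖ ^ 2 := Finset.sum_nonneg fun _ _ => by positivity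
  -- For fixed u the inequality is a closed condition on C, so it passes to the infimum.
  have hcl : poincareConst ∈ closure S := csInf_mem_closure hne ⟨0, fun C h => h.1⟩
  have hle : ‖u.fn - const (mean u.fn)‖
      ≤ poincareConst * Real.sqrt (∑ i : Fin 3, ‖u.grad i‖ ^ 2) := by
    have hclosed : IsClosed {C : ℝ | ‖u.fn - const (mean u.fn)‖
        ≤ C * Real.sqrt (∑ i : Fin 3, ‖u.grad i‖ ^ 2)} :=
      isClosed_le continuous_const (by fun_prop)
    exact closure_minimal (fun C h => h.2 u) hclosed hcl
  calc _ ≤ (poincareConst * Real.sqrt (∑ i : Fin 3, ‖u.grad i‖ ^ 2)) ^ 2 := by gcongr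
    _ = _ := by rw [mul_pow, Real.sq_sqrt hsum]

/-! ### The density -/

/-- The measurable identification of `(x, θ)` with `ξ`. -/
def glue : (Fin 2 → ℝ) × ℝ ≃ᵐ (Fin 3 → ℝ) :=
  MeasurableEquiv.prodComm.trans (MeasurableEquiv.piFinSuccAbove (fun _ : Fin 3 => ℝ) 2).symm

theorem glue_apply (p : (Fin 2 → ℝ) × ℝ) : glue p = ![p.1 0, p.1 1, p.2] := by
  ext k
  fin_cases k <;> rfl

theorem glue_symm_fst (ξ : Fin 3 → ℝ) : (glue.symm ξ).1 = ![ξ 0, ξ 1] := by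
  ext k
  fin_cases k <;> rfl

theorem measurePreserving_glue : MeasurePreserving glue
    ((volume.restrict Omega).prod (volume.restrict (Ioo 0 (2 * Real.pi))))
    (volume.restrict Upsilon) := by
  have h1 : MeasurePreserving glue (volume.prod volume) volume :=
    ((volume_preserving_piFinSuccAbove (fun _ : Fin 3 => ℝ) 2).symm _).comp
      Measure.measurePreserving_swap
  have hpre : glue ⁻¹' Upsilon = Omega ×ˢ Ioo 0 (2 * Real.pi) := by
    ext p
    rw [mem_preimage, glue_apply]
    simp [Upsilon, Omega, Fin.forall_fin_succ, and_assoc]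
  rw [Measure.prod_restrict, ← hpre]
  exact h1.restrict_preimage (MeasurableSet.univ_pi fun _ => measurableSet_Ioo)

theorem integral_glue (F : (Fin 3 → ℝ) → ℝ) :
    ∫ ξ in Upsilon, F ξ = ∫ p, F (glue p)
      ∂((volume.restrict Omega).prod (volume.restrict (Ioo 0 (2 * Real.pi)))) :=
  (measurePreserving_glue.integral_comp' F).symm

/-- The cylinder over a null set of Ω is null in Υ, so almost everywhere bounds on the density carry
over to Υ. The image measure is 2π times that of Ω, hence only quasi-preservation. -/
theorem quasiMeasurePreserving_proj : Measure.QuasiMeasurePreserving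
    (fun ξ : Fin 3 → ℝ => ![ξ 0, ξ 1]) (volume.restrict Upsilon) (volume.restrict Omega) := by
  have := Measure.quasiMeasurePreserving_fst.comp
    (measurePreserving_glue.symm _).quasiMeasurePreserving
  convert! this using 1
  ext1 ξ
  exact (glue_symm_fst ξ).symm

theorem aestronglyMeasurable_density (g : L2per) :
    AEStronglyMeasurable (density g) (volume.restrict Omega) := by
  have h := ((Lp.aestronglyMeasurable g).comp_measurePreserving
    measurePreserving_glue).integral_prod_right'
  refine h.congr (Eventually.of_forall fun x => ?_)
  simp only [density, Function.comp_apply, glue_apply]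

theorem ae_density_proj {g : L2per} (hg : DensityBounds g) :
    ∀ᵐ ξ ∂(volume.restrict Upsilon),
      0 ≤ density g ![ξ 0, ξ 1] ∧ density g ![ξ 0, ξ 1] ≤ 1 :=
  quasiMeasurePreserving_proj.ae hg

theorem aestronglyMeasurable_density_proj (g : L2per) :
    AEStronglyMeasurable (fun ξ => density g ![ξ 0, ξ 1]) (volume.restrict Upsilon) :=
  (aestronglyMeasurable_density g).comp_quasiMeasurePreserving quasiMeasurePreserving_proj

/-- Cauchy-Schwarz against 1: with M the total mass and I the integral, expand ∫ (M h - I)² ≥ 0. -/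
theorem sq_integral_le {α : Type*} [MeasurableSpace α] {ν : Measure α} [IsFiniteMeasure ν]
    {h : α → ℝ} (hh : MemLp h 2 ν) : (∫ t, h t ∂ν) ^ 2 ≤ ν.real univ * ∫ t, h t ^ 2 ∂ν := by
  have hi : Integrable h ν := hh.integrable (by norm_num)
  set I := ∫ t, h t ∂ν
  set M := ν.real univ
  have hM : 0 ≤ M := measureReal_nonneg
  have key : 0 ≤ ∫ t, (M * h t - I) ^ 2 ∂ν := integral_nonneg fun _ => sq_nonneg _
  have e : ∫ t, (M * h t - I) ^ 2 ∂ν = M * (M * (∫ t, h t ^ 2 ∂ν) - I ^ 2) := by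
    have : ∀ t, (M * h t - I) ^ 2 = M ^ 2 * h t ^ 2 - 2 * M * I * h t + I ^ 2 := fun t => by ring
    simp only [this]
    have hs : Integrable (fun t => M ^ 2 * h t ^ 2 - 2 * M * I * h t) ν :=
      (hh.integrable_sq.const_mul _).sub (hi.const_mul _)
    rw [integral_add hs (integrable_const _),
      integral_sub (hh.integrable_sq.const_mul _) (hi.const_mul _), integral_const_mul,
      integral_const_mul, integral_const, smul_eq_mul]
    ring
  rcases hM.eq_or_lt with h0 | h0
  · have : ν = 0 := by
      rw [← Measure.measure_univ_eq_zero]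
      exact (measureReal_eq_zero_iff).1 h0.symm
    simp [I, this]
  · rw [e] at key
    linarith [(mul_nonneg_iff_of_pos_left h0).1 key]

/-- Deviations of the density are controlled by deviations of the function. -/
theorem integral_density_sub_sq_le (g : L2per) (m : ℝ) :
    ∫ ξ in Upsilon, (density g ![ξ 0, ξ 1] - 2 * Real.pi * m) ^ 2
      ≤ (2 * Real.pi) ^ 2 * ‖g - const m‖ ^ 2 := by
  set I : Set ℝ := Ioo 0 (2 * Real.pi)
  set ν := volume.restrict I
  have hν : ν.real univ = 2 * Real.pi := by simp [ν, I, Real.pi_pos.le]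
  have hsub : ‖g - const m‖ ^ 2 = ∫ ξ in Upsilon, (g ξ - m) ^ 2 := by
    rw [norm_sq_L2per]
    refine integral_congr_ae ?_
    filter_upwards [Lp.coeFn_sub g (const m), coeFn_const m] with ξ h1 h2
    rw [h1, Pi.sub_apply, h2]
  have hL2 : MemLp (fun ξ => g ξ - m) 2 (volume.restrict Upsilon) :=
    (Lp.memLp g).sub (memLp_const m)
  have hP : MemLp (fun p => g (glue p) - m) 2 ((volume.restrict Omega).prod ν) :=
    hL2.comp_measurePreserving measurePreserving_glue
  have hPi : Integrable (fun p => (g (glue p) - m) ^ 2) ((volume.restrict Omega).prod ν) :=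
    hP.integrable_sq
  have hGi : Integrable (fun p => g (glue p)) ((volume.restrict Omega).prod ν) :=
    measurePreserving_glue.integrable_comp_of_integrable (integrable_L2per g)
  rw [hsub, integral_glue, integral_glue, integral_prod _ hPi]
  have e1 : ∀ p : (Fin 2 → ℝ) × ℝ, density g ![glue p 0, glue p 1] = density g p.1 := by
    intro p
    simp [density, glue_apply]
  simp only [e1]
  -- One factor 2π comes from integrating a function of x over θ; the other comes from
  -- Cauchy-Schwarz on each fibre, where ρ - 2πm is the integral of g - m.
  rw [integral_fun_fst (fun x => (density g x - 2 * Real.pi * m) ^ 2), hν, smul_eq_mul,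
    sq (2 * Real.pi), mul_assoc (2 * Real.pi)]
  refine mul_le_mul_of_nonneg_left ?_ Real.two_pi_pos.le
  rw [← integral_const_mul]
  refine integral_mono_of_nonneg (Eventually.of_forall fun x => sq_nonneg _)
    (hPi.integral_prod_left.const_mul _) ?_
  filter_upwards [hPi.prod_right_ae, hGi.prod_right_ae,
    hP.1.prodMk_left] with x h1 h2 h3
  have h4 : MemLp (fun θ => g (glue (x, θ)) - m) 2 ν :=
    (memLp_two_iff_integrable_sq h3).2 h1
  have h5 := sq_integral_le h4
  rw [hν, integral_sub h2 (integrable_const _), integral_const, hν, smul_eq_mul] at h5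
  have h6 : density g x = ∫ θ, g (glue (x, θ)) ∂ν := by
    simp only [density, glue_apply, ν, I]
  rw [h6]
  exact h5

/-! ### The drift term -/

theorem isPeriodicTest_cos : IsPeriodicTest fun ξ => Real.cos (ξ 2) := by
  refine ⟨by fun_prop, fun i ξ => ?_⟩
  fin_cases i <;> simp

theorem isPeriodicTest_sin : IsPeriodicTest fun ξ => Real.sin (ξ 2) := by
  refine ⟨by fun_prop, fun i ξ => ?_⟩
  fin_cases i <;> simp

theorem partialDeriv_comp_apply_eq_zero {h : ℝ → ℝ} (hh : Differentiable ℝ h) {i j : Fin 3}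
    (hij : i ≠ j) (ξ : Fin 3 → ℝ) : partialDeriv i (fun ξ => h (ξ j)) ξ = 0 := by
  have h1 : HasFDerivAt (fun ξ : Fin 3 → ℝ => h (ξ j)) _ ξ :=
    (hh (ξ j)).hasDerivAt.comp_hasFDerivAt ξ
      (ContinuousLinearMap.proj (R := ℝ) (φ := fun _ : Fin 3 => ℝ) j).hasFDerivAt
  rw [partialDeriv, h1.fderiv]
  simp [hij]

theorem memLp_drift_direction (φ : H1per) : MemLp (fun ξ : Fin 3 → ℝ =>
    Real.cos (ξ 2) * φ.grad 0 ξ + Real.sin (ξ 2) * φ.grad 1 ξ) 2 (volume.restrict Upsilon) := by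
  refine MemLp.add ?_ ?_
  · refine (Lp.memLp (φ.grad 0)).of_le ((by fun_prop : Continuous fun ξ : Fin 3 → ℝ =>
      Real.cos (ξ 2)).aestronglyMeasurable.mul (Lp.aestronglyMeasurable _))
      (Eventually.of_forall fun ξ => ?_)
    rw [norm_mul]
    exact mul_le_of_le_one_left (norm_nonneg _) (Real.abs_cos_le_one _)
  · refine (Lp.memLp (φ.grad 1)).of_le ((by fun_prop : Continuous fun ξ : Fin 3 → ℝ =>
      Real.sin (ξ 2)).aestronglyMeasurable.mul (Lp.aestronglyMeasurable _))
      (Eventually.of_forall fun ξ => ?_)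
    rw [norm_mul]
    exact mul_le_of_le_one_left (norm_nonneg _) (Real.abs_sin_le_one _)

/-- The field `e(θ)` is divergence free, so that it is orthogonal to gradients. -/
theorem integral_drift_direction (φ : H1per) :
    ∫ ξ in Upsilon, (Real.cos (ξ 2) * φ.grad 0 ξ + Real.sin (ξ 2) * φ.grad 1 ξ) = 0 := by
  -- The weak derivatives in x are tested against functions of θ alone, whose x-derivatives vanish.
  have h0 := φ.2 0 _ isPeriodicTest_cos
  have h1 := φ.2 1 _ isPeriodicTest_sin
  simp only [partialDeriv_comp_apply_eq_zero Real.differentiable_cos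
    (show (0 : Fin 3) ≠ 2 by decide),
    mul_zero, integral_zero] at h0
  simp only [partialDeriv_comp_apply_eq_zero Real.differentiable_sin
    (show (1 : Fin 3) ≠ 2 by decide),
    mul_zero, integral_zero] at h1
  have e0 : ∫ ξ in Upsilon, φ.grad 0 ξ * Real.cos (ξ 2) = 0 := by
    rw [← neg_eq_zero]; exact h0.symm
  have e1 : ∫ ξ in Upsilon, φ.grad 1 ξ * Real.sin (ξ 2) = 0 := by
    rw [← neg_eq_zero]; exact h1.symm
  simp only [mul_comm (Real.cos _), mul_comm (Real.sin _)]
  rw [integral_add (integrable_mul_of_continuous _ (by fun_prop))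
    (integrable_mul_of_continuous _ (by fun_prop)), e0, e1, add_zero]

/-- The drift term is controlled by the deviation from a constant and by the gradient. -/
theorem abs_mul_driftForm_le {g : L2per} (hg : DensityBounds g) (φ : H1per) (Pe : ℝ) {m μ : ℝ}
    (hm : 0 ≤ m) (hμ : 0 < μ) :
    |Pe * driftForm g φ| ≤ Pe ^ 2 * (1 + 2 * Real.pi * m) ^ 2 / (2 * μ) * ‖g - const m‖ ^ 2
      + μ / 2 * (‖φ.grad 0‖ ^ 2 + ‖φ.grad 1‖ ^ 2) := by
  set c := 2 * Real.pi * m with hc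
  have hc0 : 0 ≤ c := by positivity
  let ρ : (Fin 3 → ℝ) → ℝ := fun ξ => density g ![ξ 0, ξ 1]
  let u : (Fin 3 → ℝ) → ℝ := fun ξ => g ξ - m
  -- A equals (1 - ρ) g minus the constant m (1 - c), which `hdrift` discards.
  let A : (Fin 3 → ℝ) → ℝ := fun ξ => (1 - ρ ξ) * u ξ - m * (ρ ξ - c)
  let B : (Fin 3 → ℝ) → ℝ := fun ξ => Real.cos (ξ 2) * φ.grad 0 ξ + Real.sin (ξ 2) * φ.grad 1 ξ
  have hρm : AEStronglyMeasurable ρ (volume.restrict Upsilon) :=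
    aestronglyMeasurable_density_proj g
  have hum : AEStronglyMeasurable u (volume.restrict Upsilon) :=
    (Lp.aestronglyMeasurable g).sub aestronglyMeasurable_const
  have hB : MemLp B 2 (volume.restrict Upsilon) := memLp_drift_direction φ
  have hBi : Integrable B (volume.restrict Upsilon) := hB.integrable (by norm_num)
  have hAm : AEStronglyMeasurable A (volume.restrict Upsilon) :=
    ((aestronglyMeasurable_const.sub hρm).mul hum).sub
      (aestronglyMeasurable_const.mul (hρm.sub aestronglyMeasurable_const))
  have hu2 : Integrable (fun ξ => u ξ ^ 2) (volume.restrict Upsilon) :=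
    ((Lp.memLp g).sub (memLp_const m)).integrable_sq
  have hρb := ae_density_proj hg
  have hr2 : Integrable (fun ξ => (ρ ξ - c) ^ 2) (volume.restrict Upsilon) := by
    refine Integrable.of_bound ((hρm.sub aestronglyMeasurable_const).pow 2) ((1 + c) ^ 2) ?_
    filter_upwards [hρb] with ξ hξ
    rw [Real.norm_eq_abs, abs_of_nonneg (sq_nonneg _)]
    exact sq_le_sq' (by simp only [ρ]; linarith [hξ.1]) (by simp only [ρ]; linarith [hξ.2])
  have hunorm : ∫ ξ in Upsilon, u ξ ^ 2 = ‖g - const m‖ ^ 2 := by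
    rw [norm_sq_L2per]
    refine integral_congr_ae ?_
    filter_upwards [Lp.coeFn_sub g (const m), coeFn_const m] with ξ h1 h2
    rw [h1, Pi.sub_apply, h2]
  let D : (Fin 3 → ℝ) → ℝ := fun ξ => Pe ^ 2 / (2 * μ) * ((1 + c) * (u ξ ^ 2
    + c * ((2 * Real.pi) ^ 2)⁻¹ * (ρ ξ - c) ^ 2)) + μ / 2 * (φ.grad 0 ξ ^ 2 + φ.grad 1 ξ ^ 2)
  have hDi1 := ((hu2.add (hr2.const_mul (c * ((2 * Real.pi) ^ 2)⁻¹))).const_mul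
    (1 + c)).const_mul (Pe ^ 2 / (2 * μ))
  have hDi2 := ((integrable_sq_L2per (φ.grad 0)).add (integrable_sq_L2per (φ.grad 1))).const_mul
    (μ / 2)
  have hDi : Integrable D (volume.restrict Upsilon) := hDi1.add hDi2
  have hbd : ∀ᵐ ξ ∂(volume.restrict Upsilon), ‖Pe * (A ξ * B ξ)‖ ≤ D ξ := by
    filter_upwards [hρb] with ξ hξ
    -- Cauchy-Schwarz with weights 1 and c: (a - c r)² ≤ (1 + c)(a² + c r²), where r = (ρ - c) / 2π.
    -- The L² norms of a and r are both at most ‖g - m‖, so integration gives (1 + c)² ‖g - m‖².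
    have hA : A ξ ^ 2 ≤ (1 + c) * (u ξ ^ 2 + c * ((2 * Real.pi) ^ 2)⁻¹ * (ρ ξ - c) ^ 2) := by
      have h1 : ((1 - ρ ξ) * u ξ) ^ 2 ≤ u ξ ^ 2 := by
        rw [mul_pow]
        refine mul_le_of_le_one_left (sq_nonneg _) ?_
        exact pow_le_one₀ (by simp only [ρ]; linarith [hξ.2]) (by simp only [ρ]; linarith [hξ.1])
      have hmc : m * (ρ ξ - c) = c * ((2 * Real.pi)⁻¹ * (ρ ξ - c)) := by
        rw [hc]; field_simp
      have e : c * ((2 * Real.pi) ^ 2)⁻¹ * (ρ ξ - c) ^ 2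
          = c * ((2 * Real.pi)⁻¹ * (ρ ξ - c)) ^ 2 := by ring
      have hAe : A ξ = (1 - ρ ξ) * u ξ - c * ((2 * Real.pi)⁻¹ * (ρ ξ - c)) := by
        simp only [A]; rw [hmc]
      rw [hAe, e]
      generalize (2 * Real.pi)⁻¹ * (ρ ξ - c) = r at *
      generalize (1 - ρ ξ) * u ξ = a at *
      nlinarith [mul_nonneg hc0 (sq_nonneg (a + r)), mul_nonneg hc0 (sub_nonneg.2 h1)]
    have hBB : B ξ ^ 2 ≤ φ.grad 0 ξ ^ 2 + φ.grad 1 ξ ^ 2 := by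
      simp only [B]
      nlinarith [sq_nonneg (Real.sin (ξ 2) * φ.grad 0 ξ - Real.cos (ξ 2) * φ.grad 1 ξ),
        Real.sin_sq_add_cos_sq (ξ 2)]
    -- Young's inequality, weighted so that half of the diffusion μ is spent on the gradient.
    have hY : |Pe * (A ξ * B ξ)| ≤ Pe ^ 2 / (2 * μ) * A ξ ^ 2 + μ / 2 * B ξ ^ 2 := by
      have e : Pe ^ 2 / (2 * μ) * A ξ ^ 2 + μ / 2 * B ξ ^ 2
          = ((Pe * A ξ) ^ 2 + (μ * B ξ) ^ 2) / (2 * μ) := by field_simp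
      rw [e, le_div_iff₀ (by positivity), ← abs_of_pos (show 0 < 2 * μ by positivity), ← abs_mul,
        abs_le]
      constructor
      · nlinarith [sq_nonneg (Pe * A ξ + μ * B ξ)]
      · nlinarith [sq_nonneg (Pe * A ξ - μ * B ξ)]
    rw [Real.norm_eq_abs]
    refine hY.trans (add_le_add (mul_le_mul_of_nonneg_left hA (by positivity))
      (mul_le_mul_of_nonneg_left hBB (by positivity)))
  have hABm : AEStronglyMeasurable (fun ξ => A ξ * B ξ) (volume.restrict Upsilon) := hAm.mul hB.1
  have hPAB : |∫ ξ in Upsilon, Pe * (A ξ * B ξ)| ≤ ∫ ξ in Upsilon, D ξ :=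
    norm_integral_le_of_norm_le hDi hbd
  have hdrift : Pe * driftForm g φ = ∫ ξ in Upsilon, Pe * (A ξ * B ξ) := by
    have hi : Integrable (fun ξ => Pe * (A ξ * B ξ)) (volume.restrict Upsilon) :=
      hDi.mono' (aestronglyMeasurable_const.mul hABm) hbd
    have h1 : ∫ ξ in Upsilon, (Pe * (A ξ * B ξ) + Pe * (m * (1 - c)) * B ξ)
        = ∫ ξ in Upsilon, Pe * (A ξ * B ξ) := by
      rw [integral_add hi (hBi.const_mul _), integral_const_mul (Pe * (m * (1 - c))),
        show ∫ ξ in Upsilon, B ξ = 0 from integral_drift_direction φ, mul_zero, add_zero]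
    rw [← h1, driftForm, ← integral_const_mul]
    congr 1; ext ξ
    simp only [A, B, u, ρ]
    ring
  have hDint : ∫ ξ in Upsilon, D ξ = Pe ^ 2 / (2 * μ) * ((1 + c) * (‖g - const m‖ ^ 2
      + c * ((2 * Real.pi) ^ 2)⁻¹ * ∫ ξ in Upsilon, (ρ ξ - c) ^ 2))
      + μ / 2 * (‖φ.grad 0‖ ^ 2 + ‖φ.grad 1‖ ^ 2) := by
    rw [norm_sq_L2per (φ.grad 0), norm_sq_L2per (φ.grad 1), ← hunorm,
      ← integral_add (integrable_sq_L2per _) (integrable_sq_L2per _),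
      ← integral_const_mul (μ / 2), ← integral_const_mul (c * ((2 * Real.pi) ^ 2)⁻¹),
      ← integral_add hu2 (hr2.const_mul _), ← integral_const_mul (1 + c),
      ← integral_const_mul (Pe ^ 2 / (2 * μ))]
    exact integral_add hDi1 hDi2
  rw [hdrift]
  refine hPAB.trans ?_
  rw [hDint]
  gcongr ?_ + _
  have hρ2 := integral_density_sub_sq_le g m
  have h3 : ((2 * Real.pi) ^ 2)⁻¹ * ∫ ξ in Upsilon, (ρ ξ - c) ^ 2 ≤ ‖g - const m‖ ^ 2 := by
    rw [inv_mul_le_iff₀ (by positivity)]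
    exact hρ2
  have h4 := mul_le_mul_of_nonneg_left h3 hc0
  have h5 : (1 + c) * (‖g - const m‖ ^ 2
      + c * ((2 * Real.pi) ^ 2)⁻¹ * ∫ ξ in Upsilon, (ρ ξ - c) ^ 2)
      ≤ (1 + c) * ((1 + c) * ‖g - const m‖ ^ 2) := by
    refine mul_le_mul_of_nonneg_left ?_ (by positivity)
    rw [mul_assoc]
    linarith
  calc _ ≤ Pe ^ 2 / (2 * μ) * ((1 + c) * ((1 + c) * ‖g - const m‖ ^ 2)) :=
        mul_le_mul_of_nonneg_left h5 (by positivity)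
    _ = _ := by ring

/-! ### The weak formulation on subintervals -/

theorem spatialForm_eq_inner (u φ : H1per) :
    spatialForm u φ = inner ℝ (u.grad 0) (φ.grad 0) + inner ℝ (u.grad 1) (φ.grad 1) := by
  rw [inner_L2per, inner_L2per, spatialForm]
  exact integral_add ((Lp.memLp (u.grad 0)).integrable_mul (Lp.memLp (φ.grad 0)))
    ((Lp.memLp (u.grad 1)).integrable_mul (Lp.memLp (φ.grad 1)))

theorem angularForm_eq_inner (u φ : H1per) :
    angularForm u φ = inner ℝ (u.grad 2) (φ.grad 2) := by
  rw [inner_L2per, angularForm]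

theorem driftForm_eq_zero {φ : H1per} (h : ∀ i, φ.grad i = 0) (g : L2per) :
    driftForm g φ = 0 := by
  rw [driftForm, h 0, h 1, ← integral_zero (Fin 3 → ℝ) ℝ (μ := volume.restrict Upsilon)]
  refine integral_congr_ae ?_
  filter_upwards [Lp.coeFn_zero ℝ 2 (volume.restrict Upsilon)] with ξ hξ
  rw [hξ]
  simp

theorem grad_zero (i : Fin 3) : (0 : H1per).grad i = 0 := by
  rw [← H1per.gradL_apply, map_zero]

/-- Test functions need no regularity in time, so they may be cut off sharply; B t 0 = 0 lets the
cutoff pass through B. -/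
theorem setIntegral_indicator_Ioc {T a b : ℝ} (ha : 0 ≤ a) (hb : b < T) {Φ : ℝ → H1per}
    {B : ℝ → H1per → ℝ} (hB : ∀ t, B t 0 = 0) :
    ∫ t in Ioo 0 T, B t ((Ioc a b).indicator Φ t) = ∫ t in Ioc a b, B t (Φ t) := by
  have e : ∀ t, B t ((Ioc a b).indicator Φ t) = (Ioc a b).indicator (fun t => B t (Φ t)) t := by
    intro t
    by_cases ht : t ∈ Ioc a b
    · simp only [indicator_of_mem ht]
    · simp only [indicator_of_notMem ht, hB]
  simp only [e]
  rw [setIntegral_indicator measurableSet_Ioc, inter_eq_self_of_subset_right]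
  exact fun t ht => ⟨ha.trans_lt ht.1, ht.2.trans_lt hb⟩

/-- The weak formulation, localized in time. -/
theorem weak_formulation_Ioc {Pe De T a b : ℝ} {f : ℝ → L2per} {F : ℝ → H1per}
    {G : ℝ → StrongDual ℝ H1per}
    (h : ∀ φ : ℝ → H1per, MemL2Time T φ →
      ∫ t in Ioo 0 T, G t (φ t)
        = Pe * (∫ t in Ioo 0 T, driftForm (f t) (φ t))
          - De * (∫ t in Ioo 0 T, spatialForm (F t) (φ t))
          - ∫ t in Ioo 0 T, angularForm (F t) (φ t))
    (ha : 0 ≤ a) (hb : b < T) {Φ : ℝ → H1per} (hΦ : MemL2Time T Φ) :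
    ∫ t in Ioc a b, G t (Φ t)
        = Pe * (∫ t in Ioc a b, driftForm (f t) (Φ t))
          - De * (∫ t in Ioc a b, spatialForm (F t) (Φ t))
          - ∫ t in Ioc a b, angularForm (F t) (Φ t) := by
  have h1 := h ((Ioc a b).indicator Φ) (hΦ.indicator measurableSet_Ioc)
  rwa [setIntegral_indicator_Ioc ha hb (B := fun t v => G t v) (fun t => map_zero _),
    setIntegral_indicator_Ioc ha hb (B := fun t v => driftForm (f t) v)
      (fun t => driftForm_eq_zero grad_zero _),
    setIntegral_indicator_Ioc ha hb (B := fun t v => spatialForm (F t) v)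
      (fun t => by simp [spatialForm_eq_inner, grad_zero]),
    setIntegral_indicator_Ioc ha hb (B := fun t v => angularForm (F t) v)
      (fun t => by simp [angularForm_eq_inner, grad_zero])] at h1

theorem eq_initial_datum {T : ℝ} (hT : 0 < T) {f : ℝ → L2per} {f₀ : L2per}
    (hf : ContinuousOn f (Icc 0 T)) (h0 : Tendsto f (𝓝[>] 0) (𝓝 f₀)) : f 0 = f₀ :=
  tendsto_nhds_unique ((hf 0 ⟨le_rfl, hT.le⟩).mono_of_mem_nhdsWithin
    (Icc_mem_nhdsGT hT)).tendsto h0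

/-- The function is a primitive of its weak time derivative. -/
theorem inner_eq_add_integral {T : ℝ} (hT : 0 < T) {f : ℝ → L2per} {G : ℝ → StrongDual ℝ H1per}
    (hf : ContinuousOn f (Icc 0 T)) (hG : MemL2Time T G) (h : IsWeakTimeDeriv T f G)
    (v : H1per) {t : ℝ} (ht : t ∈ Icc 0 T) :
    inner ℝ (f t) (H1per.fnL v) = inner ℝ (f 0) (H1per.fnL v) + ∫ s in (0 : ℝ)..t, G s v := by
  refine eq_add_integral_of_weak_deriv hT (y := fun t => inner ℝ (f t) (H1per.fnL v))
    (g := fun s => G s v) (hf.inner continuousOn_const)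
    (integrable_dual_apply hG (memLp_const v)) (fun ψ h1 h2 h3 => ?_) t ht
  simp only [inner_L2per, H1per.fnL_apply]
  exact h ψ h1 h2 h3 v

/-- Conservation of mass. -/
theorem mean_eq_of_isWeakSolution {Pe De T t : ℝ} {f₀ : L2per} {f : ℝ → L2per} (hT : 0 < T)
    (hf : IsWeakSolution Pe De T f₀ f) (ht : t ∈ Ico 0 T) : mean (f t) = mean f₀ := by
  obtain ⟨hc, -, h0, F, G, -, -, hG, hw, heq⟩ := hf
  have h1 := inner_eq_add_integral hT hc hG hw oneH1 ⟨ht.1, ht.2.le⟩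
  -- Every term on the right contains the gradient of the test function, here zero.
  have h2 := weak_formulation_Ioc heq le_rfl ht.2 (Φ := fun _ => oneH1) (memLp_const _)
  simp only [driftForm_eq_zero grad_oneH1, spatialForm_eq_inner, angularForm_eq_inner, grad_oneH1,
    inner_zero_right, integral_zero, mul_zero, add_zero, sub_zero] at h2
  rw [intervalIntegral.integral_of_le ht.1, h2, add_zero, H1per.fnL_apply, fn_oneH1,
    eq_initial_datum hT hc h0] at h1
  rw [mean_eq_inner, mean_eq_inner, h1]

/-! ### The decay rate and the dissipation inequality -/

/-- The smallness condition squared is exactly positivity of the rate, since (2√2 π C (1 + m))² = 2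
C² (2π)² (1 + m)². -/
theorem decayRate_pos {Pe De m : ℝ} (hDe : 0 < De) (hm : 0 ≤ m) (hC : 0 < poincareConst)
    (hPe : |Pe| < min De 1 / (2 * Real.sqrt 2 * Real.pi * poincareConst * (1 + m))) :
    0 < decayRate Pe De m := by
  have hμ : 0 < min De 1 := lt_min hDe one_pos
  rw [decayRate]
  generalize min De 1 = μ at *
  generalize poincareConst = C at *
  have hpi := Real.pi_pos
  have h2 : 0 < Real.sqrt 2 := by positivity
  rw [lt_div_iff₀ (by positivity)] at hPe
  have h3 := pow_lt_pow_left₀ hPe (by positivity) two_ne_zero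
  have h4 : (|Pe| * (2 * Real.sqrt 2 * Real.pi * C * (1 + m))) ^ 2
      = 2 * C ^ 2 * ((2 * Real.pi) ^ 2 * Pe ^ 2 * (1 + m) ^ 2) := by
    have : Real.sqrt 2 ^ 2 = 2 := Real.sq_sqrt (by norm_num)
    rw [← sq_abs Pe]
    linear_combination (4 * |Pe| ^ 2 * Real.pi ^ 2 * C ^ 2 * (1 + m) ^ 2) * this
  rw [h4] at h3
  have h5 : (2 * Real.pi) ^ 2 * Pe ^ 2 * (1 + m) ^ 2 / μ < 1 / 2 * (C ^ 2)⁻¹ * μ := by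
    rw [div_lt_iff₀ hμ, show 1 / 2 * (C ^ 2)⁻¹ * μ * μ = μ ^ 2 / (2 * C ^ 2) by field_simp,
      lt_div_iff₀ (by positivity)]
    linarith
  linarith

/-- Dissipation of the squared distance to the mean, in integrated form. -/
theorem norm_sq_sub_le_integral {Pe De T a b : ℝ} {f₀ : L2per} {f : ℝ → L2per}
    (hDe : 0 < De) (hT : 0 < T) (hf : IsWeakSolution Pe De T f₀ f) (hm : 0 ≤ mean f₀)
    (hC : 0 < poincareConst) (ha : 0 ≤ a) (hab : a ≤ b) (hb : b < T) :
    ‖f b - const (mean f₀)‖ ^ 2 - ‖f a - const (mean f₀)‖ ^ 2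
      ≤ -(2 * decayRate Pe De (mean f₀)) * ∫ t in Ioc a b, ‖f t - const (mean f₀)‖ ^ 2 := by
  have hmean : ∀ t ∈ Ico 0 T, mean (f t) = mean f₀ := fun t ht =>
    mean_eq_of_isWeakSolution hT hf ht
  obtain ⟨hc, hd, h0, F, G, hF, hFf, hG, hw, heq⟩ := hf
  set m := mean f₀
  set μ := min De 1 with hμdef
  have hμ : 0 < μ := lt_min hDe one_pos
  have hsub : Ioc a b ⊆ Ioo 0 T := fun t ht => ⟨ha.trans_lt ht.1, ht.2.trans_lt hb⟩
  have hΦ : MemL2Time T (fun t => F t - m • oneH1) := hF.sub (memLp_const _)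
  -- Subtracting the constant m changes neither the time derivative G nor any gradient.
  have henergy := norm_sq_sub_norm_sq_eq_integral (a := a) (b := b) H1per.fnL
    (f := fun t => f t - const m) (hc.sub continuousOn_const) hΦ hG
    (by
      filter_upwards [hFf] with t ht
      rw [H1per.fnL_apply, fn_sub_smul_oneH1, ht])
    (fun v t ht => by
      rw [inner_sub_left, inner_sub_left, inner_eq_add_integral hT hc hG hw v ht]
      ring) ha hab hb
  rw [weak_formulation_Ioc heq ha hb hΦ] at henergy
  have hgrad : ∀ i, MemLp (fun t => (F t).grad i) 2 (volume.restrict (Ioc a b)) := fun i =>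
    ((H1per.gradL i).comp_memLp' hF).mono_measure (Measure.restrict_mono hsub le_rfl)
  have hgi : ∀ i, Integrable (fun t => ‖(F t).grad i‖ ^ 2) (volume.restrict (Ioc a b)) :=
    fun i => (hgrad i).integrable_norm_pow (by norm_num)
  have hyi : Integrable (fun t => ‖f t - const m‖ ^ 2) (volume.restrict (Ioc a b)) :=
    ((((hc.sub continuousOn_const).norm.pow 2).integrableOn_compact isCompact_Icc).mono_set
      (hsub.trans Ioo_subset_Icc_self))
  set K := Pe ^ 2 * (1 + 2 * Real.pi * m) ^ 2 / (2 * μ) with hK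
  set y : ℝ → ℝ := fun t => ‖f t - const m‖ ^ 2
  let S : ℝ → ℝ := fun t => ‖(F t).grad 0‖ ^ 2 + ‖(F t).grad 1‖ ^ 2
  let R : ℝ → ℝ := fun t => ‖(F t).grad 2‖ ^ 2
  have hSi : Integrable S (volume.restrict (Ioc a b)) := (hgi 0).add (hgi 1)
  have hRi : Integrable R (volume.restrict (Ioc a b)) := hgi 2
  have hdrift : Pe * (∫ t in Ioc a b, driftForm (f t) (F t - m • oneH1))
      ≤ ∫ t in Ioc a b, (K * y t + μ / 2 * S t) := by
    have hbi : Integrable (fun t => K * y t + μ / 2 * S t) (volume.restrict (Ioc a b)) :=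
      (hyi.const_mul K).add (hSi.const_mul (μ / 2))
    rw [← integral_const_mul]
    refine (Real.le_norm_self _).trans (norm_integral_le_of_norm_le hbi ?_)
    filter_upwards [ae_restrict_of_ae_restrict_of_subset hsub hd] with t ht
    have := abs_mul_driftForm_le ht (F t - m • oneH1) Pe hm hμ
    rwa [grad_sub_smul_oneH1, grad_sub_smul_oneH1] at this
  have hspace : ∀ t, spatialForm (F t) (F t - m • oneH1) = S t := fun t => by
    rw [spatialForm_eq_inner, grad_sub_smul_oneH1, grad_sub_smul_oneH1,
      real_inner_self_eq_norm_sq, real_inner_self_eq_norm_sq]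
  have hangle : ∀ t, angularForm (F t) (F t - m • oneH1) = R t := fun t => by
    rw [angularForm_eq_inner, grad_sub_smul_oneH1, real_inner_self_eq_norm_sq]
  simp only [hspace, hangle] at henergy
  -- Conservation of mass makes m the mean of f t, as Poincaré requires.
  have hpoin : ∀ᵐ t ∂(volume.restrict (Ioc a b)), y t ≤ poincareConst ^ 2 * (S t + R t) := by
    filter_upwards [ae_restrict_of_ae_restrict_of_subset hsub hFf,
      ae_restrict_mem measurableSet_Ioc] with t ht htm
    have h1 := norm_sub_mean_sq_le hC (F t)
    rw [ht, hmean t (Ioo_subset_Ico_self (hsub htm)), Fin.sum_univ_three] at h1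
    exact h1
  have htotal : (∫ t in Ioc a b, (K * y t + μ / 2 * S t)) - De * (∫ t in Ioc a b, S t)
      - ∫ t in Ioc a b, R t ≤ ∫ t in Ioc a b, -decayRate Pe De m * y t := by
    have e : (∫ t in Ioc a b, (K * y t + μ / 2 * S t)) - De * (∫ t in Ioc a b, S t)
        - ∫ t in Ioc a b, R t = ∫ t in Ioc a b, (K * y t + μ / 2 * S t - De * S t - R t) := by
      have hi1 : Integrable (fun t => K * y t + μ / 2 * S t) (volume.restrict (Ioc a b)) :=
        (hyi.const_mul K).add (hSi.const_mul (μ / 2))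
      have hi2 : Integrable (fun t => K * y t + μ / 2 * S t - De * S t)
        (volume.restrict (Ioc a b)) := hi1.sub (hSi.const_mul De)
      rw [integral_sub hi2 hRi, integral_sub hi1 (hSi.const_mul De), integral_const_mul De]
    rw [e]
    refine integral_mono_ae ((((hyi.const_mul K).add (hSi.const_mul (μ / 2))).sub
      (hSi.const_mul De)).sub hRi) (hyi.const_mul _) ?_
    filter_upwards [hpoin] with t ht
    have hS0 : 0 ≤ S t := by positivity
    have hR0 : 0 ≤ R t := by positivity
    have hy0 : 0 ≤ y t := by positivity
    have hμ1 : μ ≤ De := min_le_left _ _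
    have hμ2 : μ ≤ 1 := min_le_right _ _
    -- There is slack: 1 + 2πm ≤ 2π (1 + m), and the rate uses only half of the available Poincaré
    -- term.
    have hrate : K + decayRate Pe De m ≤ μ / 2 * (poincareConst ^ 2)⁻¹ := by
      have h1 : K ≤ 1 / 2 * ((2 * Real.pi) ^ 2 * Pe ^ 2 * (1 + m) ^ 2 / μ) := by
        have h2 : 1 + 2 * Real.pi * m ≤ 2 * Real.pi * (1 + m) := by
          nlinarith [Real.pi_gt_three]
        have h3 : (1 + 2 * Real.pi * m) ^ 2 ≤ (2 * Real.pi * (1 + m)) ^ 2 :=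
          pow_le_pow_left₀ (by positivity) h2 2
        calc K ≤ Pe ^ 2 * (2 * Real.pi * (1 + m)) ^ 2 / (2 * μ) := by rw [hK]; gcongr
          _ = _ := by field_simp
      have h4 : 0 ≤ (poincareConst ^ 2)⁻¹ * μ := by positivity
      rw [decayRate, ← hμdef]
      linarith
    have h5 : (poincareConst ^ 2)⁻¹ * y t ≤ S t + R t := by
      rw [inv_mul_le_iff₀ (by positivity)]
      exact ht
    have h6 := mul_le_mul_of_nonneg_right hrate hy0
    have h7 := mul_le_mul_of_nonneg_left h5 (show 0 ≤ μ / 2 by positivity)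
    have h8 := mul_le_mul_of_nonneg_right hμ1 hS0
    have h9 := mul_le_mul_of_nonneg_right hμ2 hR0
    nlinarith [mul_nonneg hμ.le hR0]
  rw [integral_const_mul] at htotal
  linarith

end ActiveParticles

/-- Exponential convergence in `L²` to the mean for small Péclet number. -/
theorem theorem1p7 (Pe De : ℝ) (hDe : 0 < De)
    (f₀ : ActiveParticles.L2per)
    (hf₀ : ∀ᵐ ξ ∂(volume.restrict ActiveParticles.Upsilon), 0 ≤ f₀ ξ)
    (hρ₀ : ActiveParticles.DensityBounds f₀)
    (f : ℝ → ActiveParticles.L2per)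
    (hf : ∀ T : ℝ, 0 < T → ActiveParticles.IsWeakSolution Pe De T f₀ f)
    (hPe : |Pe| < min De 1 /
      (2 * Real.sqrt 2 * Real.pi * ActiveParticles.poincareConst *
        (1 + ActiveParticles.mean f₀))) :
    0 < ActiveParticles.decayRate Pe De (ActiveParticles.mean f₀) ∧
    ∀ t : ℝ, 0 ≤ t →
      ‖f t - ActiveParticles.const (ActiveParticles.mean f₀)‖
        ≤ Real.exp (-ActiveParticles.decayRate Pe De (ActiveParticles.mean f₀) * t) *
          ‖f₀ - ActiveParticles.const (ActiveParticles.mean f₀)‖ := by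
  have hm : 0 ≤ ActiveParticles.mean f₀ := ActiveParticles.mean_nonneg hf₀
  have hC : 0 < ActiveParticles.poincareConst := by
    -- A zero constant makes the bound in `hPe` a division by zero, whose value 0 cannot exceed
    -- |Pe|.
    refine ActiveParticles.poincareConst_nonneg.lt_of_ne fun h => ?_
    rw [← h, mul_zero, zero_mul, div_zero] at hPe
    exact absurd hPe (abs_nonneg Pe).not_gt
  refine ⟨ActiveParticles.decayRate_pos hDe hm hC hPe, fun t ht => ?_⟩
  have hinit : f 0 = f₀ :=
    ActiveParticles.eq_initial_datum one_pos (hf 1 one_pos).1 (hf 1 one_pos).2.2.1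
  rcases ht.eq_or_lt with rfl | htpos
  · simp [hinit]
  have hsol := hf t htpos
  have key := ActiveParticles.le_exp_mul_of_sub_le_integral (T := t)
    (κ := 2 * ActiveParticles.decayRate Pe De (ActiveParticles.mean f₀))
    (y := fun s => ‖f s - ActiveParticles.const (ActiveParticles.mean f₀)‖ ^ 2) ht
    ((hsol.1.sub continuousOn_const).norm.pow 2)
    (fun a b ha hab hb => ActiveParticles.norm_sq_sub_le_integral hDe htpos hsol hm hC ha hab hb)
  -- The squared norm decays at rate 2κ; the square root halves it.
  refine le_of_sq_le_sq ?_ (by positivity)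
  rw [mul_pow, ← Real.exp_nat_mul]
  convert! key using 2
  · push_cast; ring_nf
  · rw [hinit]
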